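/- **Theorem ($q$-Hahn presentation).** Let $q$ be a prime power, let $n,m,k,l\ge 0$ be integers with $m\le\lfloor n/2\rfloor$, $k\le n$, $m+k-n\le l\le \min(m,k)$, and put $M:=m-l$, $N:=n-m-k+l$. Let $\mathcal V$ be an $n$-dimensional vector space over $\mathbb F_q$ with a basis $v_1,\dots,v_n$, $G:=\mathrm{GL}(\mathcal V)$, $\mathrm{Gr}(d)$ the set of $d$-dimensional subspaces of $\mathcal V$, $\mathcal U\in\mathrm{Gr}(m)$, $K:=\{g\in G\mid g\,\mathcal U=\mathcal U\}$, and $K_i:=\{g\in G\mid \dim(\mathcal U\cap g\,\mathcal U)=m-i\}$. *Notation.* $[a]_q=1+q+\dots+q^{a-1}$, $[a]_q!=[1]_q\cdots[a]_q$, $\binom{a}{b}_q=\frac{[a]_q!}{[b]_q!\,[a-b]_q!}$ for $0\le b\le a$ and $\binom{a}{b}_q=0$ for $b>a$; $(a;q)_r=\prod_{j=0}^{r-1}(1-aq^j)$, and ${}_{s+1}\phi_s\!\left[{a_1,\dots,a_{s+1}\atop b_1,\dots,b_s};q,z\right]=\sum_{r\ge0}\frac{(a_1;q)_r\cdots(a_{s+1};q)_r}{(q;q)_r(b_1;q)_r\cdots(b_s;q)_r}z^r$,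 where a terminating series is cut off as soon as its numerators vanish. Put $$c_x:=q^x\,\frac{\binom{n}{x}_q}{\binom{n}{m}_q}\,\frac{[n-2x+1]_q}{[n-x+1]_q},\qquad p(x;q):=\binom{n-k}{m-l}_q\,c_x\;{}_4\phi_3\!\left[{q^{-x},\,q^{x-n-1},\,q^{-M},\,q^{-N}\atop q^{-m},\,q^{m-n},\,q^{-M-N}};q,q\right].$$ *The irreducible representations.* The induced representation $1_K^G$ is the space of complex functions on $\mathrm{Gr}(m)\cong G/K$. For $0\le x\le m$ let $U_x\subset 1_K^G$ be the span of the functions $\mathcal W\mapsto 1_{[A\subset\mathcal W]}$, $A\in\mathrm{Gr}(x)$, and let $V_x\subset U_x$ be the subrepresentation of those $f\in U_x$ with $\sum_{\mathcal W\in\mathrm{Gr}(m),\,\mathcal W\supset B}f(\mathcal W)=0$ for all subspaces $B\subset\mathcal V$ with $\dim B<x$. With $\chi_x$ the character of $V_x$, the zonal spherical function is $\omega_x(g):=|K|^{-1}\sum_{\kappa\in K}\overline{\chi_x(g\kappa^{-1})}$. *The quantity $\tilde p$.* Let $\mathbb P$ be the set of lines in $\mathcal V$ and $T:=(\mathbb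 C^2)^{\otimes\mathbb P}=(\mathbb C^2)^{\otimes[n]_q}$, with the Hermitian form induced by the standard one on $\mathbb C^2=\mathbb C|0\rangle\oplus\mathbb C|1\rangle$; $G$ acts on $T$ by permuting the tensor factors via its action on $\mathbb P$. Let $\mathsf P_x$ be the orthogonal projector of $T$ onto its isotypic component of type $V_x$ (the sum of all subrepresentations isomorphic to $V_x$). For a subspace $\mathcal W\subset\mathcal V$ let $|e_{\mathcal W}\rangle:=\bigotimes_{L\in\mathbb P}e^{(L)}_{\mathcal W}$ with $e^{(L)}_{\mathcal W}=|1\rangle$ if $L\subset\mathcal W$ and $|0\rangle$ otherwise. Let $\mathrm{Gr}(n,m|k,l)$ be the set of $\mathcal W\in\mathrm{Gr}(m)$ with $\langle v_1,\dots,v_l\rangle\subset\mathcal W$ and $\dim(\mathcal W\cap\langle v_{k+1},\dots,v_n\rangle)=m-l$, and $$|\Xi\rangle:=\binom{n-k}{m-l}_q^{-1/2}\sum_{\mathcal W\in\mathrm{Gr}(n,m|k,l)}|e_{\mathcal W}\rangle,\qquad \tilde p(x;q):=\langle\Xi|\mathsf P_x|\Xi\rangle .$$ *Claim.* $1_K^G=\bigoplus_{x=0}^m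 V_x$ is a decomposition into irreducible representations, with $\dim V_x=q^x\frac{[n-2x+1]_q}{[n-x+1]_q}\binom{n}{x}_q$. Moreover, for every $x\in\{0,\dots,m\}$ and all $g_i\in K_i$ $(0\le i\le m)$, $$\tilde p(x;q)=c_x\sum_{i=0}^{m}q^{i^2}\binom{M}{i}_q\binom{N}{i}_q\,\omega_x(g_i) =c_x\sum_{i=0}^{m}q^{i^2}\binom{M}{i}_q\binom{N}{i}_q\;{}_3\phi_2\!\left[{q^{-i},\,q^{-x},\,q^{x-n-1}\atop q^{-m},\,q^{m-n}};q,q\right],$$ and $\tilde p(x;q)=p(x;q)$; in particular $p(x;q)\ge 0$. -/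

import Mathlib

open scoped TensorProduct ComplexConjugate

noncomputable section

/-! ### `q`-numbers and basic hypergeometric series -/

/-- The `q`-shifted factorial `(a;q)_r = (1 - a)(1 - a q) ⋯ (1 - a q^{r-1})`. -/
def qPoch (a q : ℝ) (r : ℕ) : ℝ := ∏ j ∈ Finset.range r, (1 - a * q ^ j)

/-- The `q`-integer `[n]_q = 1 + q + ⋯ + q^{n-1}`. -/
def qInt (q : ℝ) (n : ℕ) : ℝ := ∑ j ∈ Finset.range n, q ^ j

/-- The `q`-factorial `[n]_q! = [1]_q [2]_q ⋯ [n]_q`. -/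
def qFact (q : ℝ) (n : ℕ) : ℝ := ∏ j ∈ Finset.range n, qInt q (j + 1)

/-- The `q`-binomial coefficient, equal to `0` for `n < m`. -/
def qBinom (q : ℝ) (n m : ℕ) : ℝ :=
  if m ≤ n then qFact q n / (qFact q m * qFact q (n - m)) else 0

/-- The basic hypergeometric series `_rφ_s(a₁,…,a_r; b₁,…,b_s; q, z)`. In a terminating series
all terms beyond the termination index have numerator `0`, hence vanish. -/
def qHyp (a b : List ℝ) (q z : ℝ) : ℝ :=
  ∑' i : ℕ, (a.map fun c => qPoch c q i).prod / (qPoch q q i * (b.map fun c => qPoch c q i).prod)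
    * ((-1) ^ i * q ^ (i.choose 2)) ^ (1 + (b.length : ℤ) - (a.length : ℤ)) * z ^ i

/-- The factor `q^x [n choose x]_q / [n choose m]_q * [n-2x+1]_q / [n-x+1]_q`. -/
def qPrefactor (q : ℝ) (n m x : ℕ) : ℝ :=
  q ^ x * (qBinom q n x / qBinom q n m) * (qInt q (n - 2 * x + 1) / qInt q (n - x + 1))

/-- The function `p(x | n,m,k,l; q)`; here `m - l = M` and `n + l - m - k = N`. -/
def qRacahPmf (q : ℝ) (n m k l x : ℕ) : ℝ :=
  qBinom q (n - k) (m - l) * qPrefactor q n m x *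
    qHyp [q ^ (-(x : ℤ)), q ^ ((x : ℤ) - n - 1), q ^ (-((m - l : ℕ) : ℤ)),
          q ^ (-((n + l - m - k : ℕ) : ℤ))]
      [q ^ (-(m : ℤ)), q ^ ((m : ℤ) - n), q ^ (-((m - l : ℕ) : ℤ) - ((n + l - m - k : ℕ) : ℤ))]
      q q

/-- The `q`-Hahn polynomial value `_3φ_2(q^{-i}, q^{-x}, q^{x-n-1}; q^{-m}, q^{m-n}; q, q)`. -/
def qHahnValue (q : ℝ) (n m x i : ℕ) : ℝ :=
  qHyp [q ^ (-(i : ℤ)), q ^ (-(x : ℤ)), q ^ ((x : ℤ) - n - 1)]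
    [q ^ (-(m : ℤ)), q ^ ((m : ℤ) - n)] q q

/-! ### Grassmannians over a finite field and the action of the general linear group -/

section Grassmannian

variable (F : Type*) [Field F] (V : Type*) [AddCommGroup V] [Module F V]

/-- The set of `d`-dimensional linear subspaces of `V`. -/
def Gr (d : ℕ) : Type _ := {W : Submodule F V // Module.finrank F W = d}

/-- The lines in `V`, that is, the points of the projective space of `V`. -/
abbrev Lines : Type _ := Gr F V 1

variable {F V}

/-- The action `W ↦ g W` of `GL(V)` on `d`-dimensional subspaces. -/
instance Gr.instMulAction (d : ℕ) : MulAction (V ≃ₗ[F] V) (Gr F V d) where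
  smul g W := ⟨W.1.map (g : V →ₗ[F] V), (LinearEquiv.finrank_map_eq g W.1).trans W.2⟩
  one_smul W := Subtype.ext (Submodule.map_id W.1)
  mul_smul g h W := Subtype.ext (Submodule.map_comp (h : V →ₗ[F] V) (g : V →ₗ[F] V) W.1)

theorem Gr.smul_val {d : ℕ} (g : V ≃ₗ[F] V) (W : Gr F V d) :
    (g • W).1 = W.1.map (g : V →ₗ[F] V) := rfl

variable [Finite F] [FiniteDimensional F V]

instance Gr.instFinite (d : ℕ) : Finite (Gr F V d) := by
  have : Finite V := Module.finite_of_finite F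
  have : Finite (Submodule F V) := Finite.of_injective _ SetLike.coe_injective
  exact Subtype.finite

instance Gr.instFintype (d : ℕ) : Fintype (Gr F V d) := Fintype.ofFinite _

instance finite_generalLinear : Finite (V ≃ₗ[F] V) := by
  have : Finite V := Module.finite_of_finite F
  exact Finite.of_injective (fun g : V ≃ₗ[F] V => (g : V → V)) DFunLike.coe_injective

end Grassmannian

/-! ### The induced representation `1_K^G` and its constituents `V_x` -/

section Constituents

variable (F : Type*) [Field F] (V : Type*) [AddCommGroup V] [Module F V]

/-- The induced representation `1_K^G`, that is, the permutation representation of `G = GL(V)` on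
the space of complex functions on `G/K ≅ Gr(m,n)`, where `K` is the stabilizer of
an `m`-dimensional subspace: `(g f)(W) = f(g⁻¹ W)`. -/
def permRep (m : ℕ) : Representation ℂ (V ≃ₗ[F] V) (Gr F V m → ℂ) where
  toFun g := LinearMap.funLeft ℂ ℂ fun W => g⁻¹ • W
  map_one' := by
    ext f W
    simp [LinearMap.funLeft_apply]
  map_mul' g h := by
    refine LinearMap.ext fun f => funext fun W => ?_
    simp only [LinearMap.funLeft_apply, Module.End.mul_apply, mul_inv_rev, mul_smul]

variable {F V}

theorem permRep_apply (m : ℕ) (g : V ≃ₗ[F] V) (f : Gr F V m → ℂ) (W : Gr F V m) :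
    permRep F V m g f W = f (g⁻¹ • W) := rfl

open Classical in
/-- The indicator function of the set of `W` in `Gr(m,n)` containing `A`. -/
def upFun (m : ℕ) (A : Submodule F V) (W : Gr F V m) : ℂ := if A ≤ W.1 then 1 else 0

theorem Gr.le_inv_smul_iff {m : ℕ} (g : V ≃ₗ[F] V) (A : Submodule F V) (W : Gr F V m) :
    A ≤ (g⁻¹ • W).1 ↔ A.map (g : V →ₗ[F] V) ≤ W.1 := by
  rw [Gr.smul_val, Submodule.map_le_iff_le_comap]
  have : W.1.map ((g⁻¹ : V ≃ₗ[F] V) : V →ₗ[F] V) = W.1.comap (g : V →ₗ[F] V) :=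
    Submodule.map_equiv_eq_comap_symm g.symm W.1
  rw [this]

theorem permRep_upFun (m : ℕ) (g : V ≃ₗ[F] V) (A : Submodule F V) :
    permRep F V m g (upFun m A) = upFun m (A.map (g : V →ₗ[F] V)) := by
  funext W
  have h := Gr.le_inv_smul_iff g A W
  rw [permRep_apply]
  by_cases h' : A.map (g : V →ₗ[F] V) ≤ W.1
  · rw [upFun, upFun, if_pos h', if_pos (h.2 h')]
  · rw [upFun, upFun, if_neg h', if_neg (fun h'' => h' (h.1 h''))]

end Constituents

section Irreducibles

variable (F : Type*) [Field F] [Finite F] (V : Type*) [AddCommGroup V] [Module F V]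
  [FiniteDimensional F V]

/-- The constituent `V_x` of `1_K^G`, `x ≤ m ≤ n - m`: writing `U_y` for the span of the indicator
functions of the sets `{W | A ⊆ W}`, `dim A = y`, so that `U_0 ⊆ U_1 ⊆ ⋯ ⊆ U_m`, it is the
orthogonal complement of `U_{x-1}` in `U_x` (and it is `U_0` for `x = 0`). Since `U_x` is
a copy of `ℂ[Gr(x,n)]`, the character of `V_x` is the difference of the permutation characters on
`Gr(x,n)` and `Gr(x-1,n)`: it is the unipotent character of the partition `(n-x,x)`. -/
def irrepV (m x : ℕ) : Subrepresentation (permRep F V m) where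
  toSubmodule :=
    { carrier := {f | f ∈ Submodule.span ℂ (Set.range fun A : Gr F V x => upFun m A.1) ∧
        ∀ B : Submodule F V, Module.finrank F B < x →
          ∑ W : Gr F V m, upFun m B W * f W = 0}
      zero_mem' := ⟨Submodule.zero_mem _, fun B _ => by simp⟩
      add_mem' := by
        rintro f f' ⟨h₁, h₂⟩ ⟨h₃, h₄⟩
        refine ⟨Submodule.add_mem _ h₁ h₃, fun B hB => ?_⟩
        simp [mul_add, Finset.sum_add_distrib, h₂ B hB, h₄ B hB]
      smul_mem' := by
        rintro c f ⟨h₁, h₂⟩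
        refine ⟨Submodule.smul_mem _ c h₁, fun B hB => ?_⟩
        simp [mul_left_comm _ c, ← Finset.mul_sum, h₂ B hB] }
  apply_mem_toSubmodule := by
    rintro g f ⟨h₁, h₂⟩
    refine ⟨?_, fun B hB => ?_⟩
    · refine (Submodule.span_le (p := (Submodule.span ℂ
        (Set.range fun A : Gr F V x => upFun m A.1)).comap (permRep F V m g))).2 ?_ h₁
      rintro _ ⟨A, rfl⟩
      rw [SetLike.mem_coe, Submodule.mem_comap]
      beta_reduce
      rw [permRep_upFun]
      exact Submodule.subset_span ⟨g • A, rfl⟩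
    · rw [← h₂ (B.map ((g⁻¹ : V ≃ₗ[F] V) : V →ₗ[F] V))
        (by rwa [LinearEquiv.finrank_map_eq g⁻¹ B])]
      refine Fintype.sum_equiv (MulAction.toPerm g⁻¹) _ _ fun W => ?_
      rw [permRep_apply, MulAction.toPerm_apply, ← permRep_upFun, permRep_apply, inv_inv,
        smul_inv_smul]

/-- The action of `G = GL(V)` on `V_x`. -/
def irrepRep (m x : ℕ) : Representation ℂ (V ≃ₗ[F] V) (irrepV F V m x).toSubmodule :=
  (irrepV F V m x).toRepresentation

variable {F V}

/-- The zonal spherical function `ω_x = conj χ_x * e_K` of `V_x`, where `K` is the stabilizer of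
the `m`-dimensional subspace `U` and `χ_x` is the character of `V_x`:
`ω_x(g) = |K|⁻¹ ∑_{κ ∈ K} conj χ_x(g κ⁻¹)`. -/
def zonalSpherical {m : ℕ} (U : Gr F V m) (x : ℕ) (g : V ≃ₗ[F] V) : ℂ :=
  letI : Fintype (MulAction.stabilizer (V ≃ₗ[F] V) U) := Fintype.ofFinite _
  (Nat.card (MulAction.stabilizer (V ≃ₗ[F] V) U) : ℂ)⁻¹ *
    ∑ κ : MulAction.stabilizer (V ≃ₗ[F] V) U,
      conj ((irrepRep F V m x).character (g * (κ : V ≃ₗ[F] V)⁻¹))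

/-- The double coset `K_i = {g | dim(U ∩ g U) = m - i}` of the stabilizer `K` of `U`. -/
def doubleCosetK {m : ℕ} (U : Gr F V m) (i : ℕ) : Set (V ≃ₗ[F] V) :=
  {g | Module.finrank F ↥(U.1 ⊓ (g • U).1) + i = m}

end Irreducibles

/-! ### The Hermitian space `(ℂ²)^{⊗ ι}` -/

section Tensor

/-- The space `ℂ² = ℂ|0⟩ ⊕ ℂ|1⟩` with its standard Hermitian form. -/
abbrev Qubit : Type := EuclideanSpace ℂ (Fin 2)

/-- The basis vectors `|0⟩` and `|1⟩` of `ℂ²`. -/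
abbrev ket (a : Fin 2) : Qubit := EuclideanSpace.single a 1

/-- The tensor power `(ℂ²)^{⊗ ι}`. -/
def QubitTensor (ι : Type*) : Type _ := ⨂[ℂ] _ : ι, Qubit

namespace QubitTensor

variable {ι : Type*}

instance : AddCommGroup (QubitTensor ι) := PiTensorProduct.instAddCommGroup

instance : Module ℂ (QubitTensor ι) := PiTensorProduct.instModule

/-- The pure tensor `⊗_{L} t^{(L)}`. -/
def pure (t : ι → Qubit) : QubitTensor ι := PiTensorProduct.tprod ℂ t

/-- The basis of `(ℂ²)^{⊗ ι}` formed by the tensor products of the vectors `|0⟩`, `|1⟩`. -/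
def basis (ι : Type*) [Finite ι] : Module.Basis (ι → Fin 2) ℂ (QubitTensor ι) :=
  Basis.piTensorProduct fun _ : ι => (EuclideanSpace.basisFun (Fin 2) ℂ).toBasis

instance [Finite ι] : FiniteDimensional ℂ (QubitTensor ι) := (basis ι).finiteDimensional_of_finite

variable [Fintype ι]

open Classical in
/-- The Hermitian form on `(ℂ²)^{⊗ ι}` (anti-linear in the first variable) for which the above
basis is orthonormal; see `QubitTensor.inner_pure` for its value on pure tensors. -/
abbrev core (ι : Type*) [Fintype ι] : InnerProductSpace.Core ℂ (QubitTensor ι) where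
  inner s t := ∑ p, conj ((basis ι).repr s p) * (basis ι).repr t p
  conj_inner_symm s t := by simp [map_sum, mul_comm]
  re_inner_nonneg s := by
    simp only [map_sum]
    refine Finset.sum_nonneg fun p _ => ?_
    rw [← Complex.normSq_eq_conj_mul_self]
    exact Complex.normSq_nonneg _
  add_left s t u := by simp [add_mul, Finset.sum_add_distrib]
  smul_left s t c := by simp [Finset.mul_sum, mul_assoc]
  definite s hs := by
    have h : ∑ p, Complex.normSq ((basis ι).repr s p) = 0 := by
      have : ((∑ p, Complex.normSq ((basis ι).repr s p) : ℝ) : ℂ) = 0 := by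
        rw [← hs]
        simp only [Complex.ofReal_sum, Complex.normSq_eq_conj_mul_self]
      exact_mod_cast this
    rw [Finset.sum_eq_zero_iff_of_nonneg fun p _ => Complex.normSq_nonneg _] at h
    refine (basis ι).ext_elem fun p => ?_
    simpa using h p (Finset.mem_univ p)

instance : NormedAddCommGroup (QubitTensor ι) :=
  { (core ι).toNormedAddCommGroup with toAddCommGroup := instAddCommGroup }

instance : InnerProductSpace ℂ (QubitTensor ι) := InnerProductSpace.ofCore (core ι).toCore

theorem inner_pure (s t : ι → Qubit) :
    inner ℂ (pure s) (pure t) = ∏ L, inner ℂ (s L) (t L) := by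
  classical
  have h : ∀ (t : ι → Qubit) p, (basis ι).repr (pure t) p = ∏ L, t L (p L) := fun t p => by
    refine (Basis.piTensorProduct_repr_tprod_apply
      (fun _ : ι => (EuclideanSpace.basisFun (Fin 2) ℂ).toBasis) t p).trans ?_
    simp
  show ∑ p, conj ((basis ι).repr (pure s) p) * (basis ι).repr (pure t) p = _
  simp only [h, PiLp.inner_apply, Finset.prod_univ_sum, map_prod, Fintype.piFinset_univ]
  refine Finset.sum_congr rfl fun p _ => ?_
  rw [← Finset.prod_mul_distrib]
  refine Finset.prod_congr rfl fun L _ => ?_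
  simp [mul_comm]

end QubitTensor

end Tensor

/-! ### The `GL(V)`-representation on `(ℂ²)^{⊗ ℙ(V)}` and the quantity `p̃(x;q)` -/

section Representation

/-- The linear map of `(ℂ²)^{⊗ ι}` permuting the tensor factors. -/
def QubitTensor.perm {ι : Type*} (σ : Equiv.Perm ι) : QubitTensor ι →ₗ[ℂ] QubitTensor ι :=
  (PiTensorProduct.reindex ℂ (fun _ : ι => Qubit) σ).toLinearMap

theorem QubitTensor.perm_pure {ι : Type*} (σ : Equiv.Perm ι) (t : ι → Qubit) :
    QubitTensor.perm σ (QubitTensor.pure t) = QubitTensor.pure fun L => t (σ.symm L) :=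
  PiTensorProduct.reindex_tprod σ t

theorem QubitTensor.hom_ext {ι : Type*} {f g : QubitTensor ι →ₗ[ℂ] QubitTensor ι}
    (h : ∀ t, f (QubitTensor.pure t) = g (QubitTensor.pure t)) : f = g :=
  PiTensorProduct.ext (MultilinearMap.ext h)

variable (F : Type*) [Field F] (V : Type*) [AddCommGroup V] [Module F V]

/-- The representation `φ` of `G = GL(V)` on `T = (ℂ²)^{⊗ ℙ(V)}` by permutation of the tensor
factors through the action of `G` on the set of lines. -/
def lineRep : Representation ℂ (V ≃ₗ[F] V) (QubitTensor (Lines F V)) where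
  toFun g := QubitTensor.perm (MulAction.toPerm g)
  map_one' := QubitTensor.hom_ext fun t => by
    rw [QubitTensor.perm_pure, Module.End.one_apply]
    congr 1
    funext L
    exact congrArg t ((Equiv.symm_apply_eq _).2 (one_smul (V ≃ₗ[F] V) L).symm)
  map_mul' g h := QubitTensor.hom_ext fun t => by
    rw [Module.End.mul_apply, QubitTensor.perm_pure, QubitTensor.perm_pure, QubitTensor.perm_pure]
    congr 1
    funext L
    refine congrArg t ?_
    show (g * h)⁻¹ • L = h⁻¹ • g⁻¹ • L
    rw [mul_inv_rev, mul_smul]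

variable {F V}

open Classical in
/-- The vector `|e_W⟩ = ⊗_L e_W^{(L)}` with `e_W^{(L)} = |1⟩` if `L ⊆ W` and `|0⟩` otherwise. -/
def eKet (W : Submodule F V) : QubitTensor (Lines F V) :=
  QubitTensor.pure fun L => if L.1 ≤ W then ket 1 else ket 0

theorem lineRep_eKet (g : V ≃ₗ[F] V) (W : Submodule F V) :
    lineRep F V g (eKet W) = eKet (W.map (g : V →ₗ[F] V)) := by
  classical
  show QubitTensor.perm (MulAction.toPerm g) _ = _
  unfold eKet
  rw [QubitTensor.perm_pure]
  congr 1
  funext L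
  have h : (g⁻¹ • L).1 ≤ W ↔ L.1 ≤ W.map (g : V →ₗ[F] V) := by
    rw [Gr.smul_val, Submodule.map_le_iff_le_comap]
    have : W.comap ((g⁻¹ : V ≃ₗ[F] V) : V →ₗ[F] V) = W.map (g : V →ₗ[F] V) :=
      (Submodule.map_equiv_eq_comap_symm g W).symm
    rw [this]
  show (if (g⁻¹ • L).1 ≤ W then _ else _) = _
  simp only [h]

variable [Finite F] [FiniteDimensional F V]

/-- The isotypic component of a representation `φ` of type `ρ`: the sum of all
subrepresentations of `φ` that are isomorphic to `ρ`. -/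
def isotypicPart {G T S : Type*} [Group G] [AddCommGroup T] [Module ℂ T] [AddCommGroup S]
    [Module ℂ S] (φ : Representation ℂ G T) (ρ : Representation ℂ G S) : Submodule ℂ T :=
  ⨆ (σ : Subrepresentation φ) (_ : Nonempty (Representation.Equiv σ.toRepresentation ρ)),
    σ.toSubmodule

/-- The orthogonal projector `P_x` of `T` onto its isotypic component of type `V_x ⊆ 1_K^G`. -/
def isotypicProj (F : Type*) [Field F] [Finite F] (V : Type*) [AddCommGroup V] [Module F V]
    [FiniteDimensional F V] (m x : ℕ) :
    QubitTensor (Lines F V) →L[ℂ] QubitTensor (Lines F V) :=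
  (isotypicPart (lineRep F V) (irrepRep F V m x)).starProjection

/-- `Gr(n,m | k,l)`: the `m`-dimensional subspaces `W` of `V` that contain
`V_l = ⟨v_1,…,v_l⟩` and satisfy `dim(W ∩ ⟨v_{k+1},…,v_n⟩) = m - l`
(the basis vectors are indexed by `0,…,n-1` here). -/
def grSubset {n : ℕ} (v : Module.Basis (Fin n) F V) (m k l : ℕ) : Set (Gr F V m) :=
  {W | Submodule.span F (v '' {j | (j : ℕ) < l}) ≤ W.1 ∧
    Module.finrank F ↥(W.1 ⊓ Submodule.span F (v '' {j | k ≤ (j : ℕ)})) = m - l}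

open Classical in
/-- The vector `|Ξ_{n,m|k,l;q}⟩`, with `q = |F|`. -/
def xiKet {n : ℕ} (v : Module.Basis (Fin n) F V) (m k l : ℕ) : QubitTensor (Lines F V) :=
  (((Real.sqrt (qBinom (Nat.card F) (n - k) (m - l)))⁻¹ : ℝ) : ℂ) •
    ∑ W : Gr F V m, if W ∈ grSubset v m k l then eKet W.1 else 0

/-- `p̃(x;q) = ⟨Ξ| P_x |Ξ⟩`, with `q = |F|`. -/
def pTilde {n : ℕ} (v : Module.Basis (Fin n) F V) (m k l x : ℕ) : ℂ :=
  inner ℂ (xiKet v m k l) (isotypicProj F V m x (xiKet v m k l))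

end Representation

end

/-!
Functions on `Gr(m)` carry the operator `adjOp`: sum over the hyperplanes of `W`, then over the
subspaces covering them. It commutes with `GL(V)`, is symmetric, and maps the function `upFun m A`
(`W ↦ 1_{A ⊆ W}`) with `dim A = x` to `η_x` times itself plus functions `upFun m B` with `B` a
hyperplane of `A` (`adjOp_upFun`), with `η_x = adjEig q n m x` strictly decreasing in `x`. Hence
`V_x`, which is the orthogonal complement of `U_{x-1}` in `U_x`, is the whole eigenspace for `η_x`
(`irrepV_eq_eigenspace`) and the `V_x` decompose `1_K^G` (`isInternal_irrepV`). The functions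
`upFun m A`, `dim A = x`, are linearly independent, because inclusion of `x`-spaces in `m`-spaces
has full rank for `x ≤ m ≤ n/2` (`eq_zero_of_sum_mul_supInd_eq_zero`); so `dim V_x` is the
difference of two consecutive `q`-binomials (`finrank_irrepV`).

The `q`-Hahn polynomials come out of the same operator in another basis. For fixed `U ∈ Gr(m)` let
`disjSum U r W` be the number of `r`-dimensional subspaces of `U` meeting `W` trivially; up to a
factor it is `(q^{-i};q)_r` with `i = m - dim (U ∩ W)`. On these functions the operator is
bidiagonal, and solving the two-term recursion for the eigenvalue `η_x` gives exactly the
coefficients of the `₃φ₂` (`sphCoeff_mul_prod`, `adjOp_sphFun`). So `sphFun x U`, the `q`-Hahn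
polynomial of the distance to `U`, lies in `V_x`. The `m + 1` functions `sphFun x U` span all
functions of the distance to `U`, in particular the point mass at `U`; therefore the projector onto
`V_x` has a multiple of `sphFun x` as its kernel, and comparing traces identifies the factor as
`c_x` (`projOp_eq_self`). Since `GL(V)` is transitive on pairs at a given distance, a function in
`V_x` fixed by the stabilizer of `U` is a multiple of `sphFun x U` (`eq_smul_sphFun_of_radial`).
Averaging over the stabilizer then shows that `V_x` is irreducible (`isIrreducible_irrepRep`) and
that its zonal spherical function is `sphFun x` (`zonalSpherical_eq_sphFun`).

The vectors `|e_W⟩`, `W ∈ Gr(m)`, are orthonormal and span a copy of `1_K^G` in `T`. A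
`GL(V)`-invariant operator on `1_K^G` has a symmetric kernel, so all such operators commute
(Gelfand's trick); in particular they commute with the projector onto `V_x`, and `V_x` is the only
subrepresentation of its type (`intertwiner_mem_irrepV`). Hence the adjoint of the embedding maps
the isotypic component of `T` into `V_x`, and on the copy of `1_K^G` the isotypic projector is the
projector onto `V_x` (`isotypicProj_grKet`). Thus `p̃` is `c_x` times the average over
`W ∈ Gr(n,m|k,l)` of the sum of `sphFun x W W'` over `W' ∈ Gr(n,m|k,l)` (`pTilde_eq_sum`). The set
`Gr(n,m|k,l)` consists of the subspaces `W` of dimension `m` with `P ⊆ W ⊆ P + Q`, where `P` and `Q`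
are the spans of the first `l` and of the last `n - k` basis vectors (`sum_grSubset_eq`). Given `W`,
the number of `W'` at distance `i` in this interval is `q^{i²} [M,i]_q [N,i]_q`, which gives the
first evaluation; summing `(q^{-i};q)_r` over the interval instead, which is again a count of
subspaces (`card_relDisj`), turns the `₃φ₂` into the `₄φ₃`.
-/

noncomputable section

/-! ### `q`-integers -/

section QInt

variable {q : ℝ}

theorem qInt_zero : qInt q 0 = 0 := by simp [qInt]

theorem qInt_succ (n : ℕ) : qInt q (n + 1) = qInt q n + q ^ n := Finset.sum_range_succ _ _

theorem sub_one_mul_qInt (n : ℕ) : (q - 1) * qInt q n = q ^ n - 1 := mul_geom_sum q n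

theorem qInt_eq_div (hq : 1 < q) (n : ℕ) : qInt q n = (q ^ n - 1) / (q - 1) := by
  rw [eq_div_iff (by linarith), mul_comm, sub_one_mul_qInt]

theorem qInt_pos (hq : 1 < q) {n : ℕ} (hn : 0 < n) : 0 < qInt q n :=
  Finset.sum_pos (fun j _ => pow_pos (by linarith) j) (by simpa using hn.ne')

theorem qInt_add (a b : ℕ) : qInt q (a + b) = qInt q a + q ^ a * qInt q b := by
  rw [qInt, Finset.sum_range_add, qInt, qInt, Finset.mul_sum]
  simp [pow_add]

theorem qInt_strictMono (hq : 1 < q) : StrictMono (qInt q) :=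
  strictMono_nat_of_lt_succ fun n => by
    rw [qInt_succ]
    have : 0 < q ^ n := pow_pos (by linarith) n
    linarith

theorem qFact_succ (n : ℕ) : qFact q (n + 1) = qFact q n * qInt q (n + 1) :=
  Finset.prod_range_succ _ _

theorem qFact_pos (hq : 1 < q) (n : ℕ) : 0 < qFact q n :=
  Finset.prod_pos fun _ _ => qInt_pos hq (Nat.succ_pos _)

end QInt

/-! ### Counting subspaces between two given ones -/

section Counting

open Module

variable {F : Type*} [Field F] {V : Type*} [AddCommGroup V] [Module F V] [FiniteDimensional F V]

theorem natCard_submodule (W : Submodule F V) : Nat.card W = Nat.card F ^ finrank F W :=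
  Module.natCard_eq_pow_finrank

open Classical in
theorem card_filter_mem_diff [Fintype V] {H W : Submodule F V} (h : H ≤ W) :
    ((Finset.univ.filter fun v : V => v ∈ W ∧ v ∉ H).card : ℝ) =
      (Nat.card F : ℝ) ^ finrank F W - (Nat.card F : ℝ) ^ finrank F H := by
  have hW : ∀ W : Submodule F V,
      (Finset.univ.filter fun v : V => v ∈ W).card = Nat.card F ^ finrank F W := fun W => by
    rw [← natCard_submodule W, Nat.card_eq_fintype_card, Fintype.card_subtype]
  have h1 : (Finset.univ.filter fun v : V => v ∈ W ∧ v ∉ H) =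
      (Finset.univ.filter fun v : V => v ∈ W) \ (Finset.univ.filter fun v : V => v ∈ H) := by
    ext v; simp
  rw [h1, Finset.cast_card_sdiff, hW, hW]
  · push_cast; rfl
  · intro v; simpa using fun hv => h hv

/-- If `B ∩ U = C` and `A` covers `B`, then `A ∩ U` is again `C` unless `A ⊆ B + U`. -/
theorem inf_eq_iff_not_le_sup {A B C U : Submodule F V} (hBA : B ≤ A)
    (hdim : finrank F A = finrank F B + 1) (hC : B ⊓ U = C) : A ⊓ U = C ↔ ¬ A ≤ B ⊔ U := by
  constructor
  · intro h hle
    have h1 : A = B ⊔ U ⊓ A := by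
      rw [← sup_inf_assoc_of_le U hBA, inf_eq_right.2 hle]
    have h2 : A ≤ B := by
      rw [h1]
      refine sup_le le_rfl ?_
      rw [inf_comm, h, ← hC]
      exact inf_le_left
    have := Submodule.finrank_mono h2
    omega
  · intro hle
    by_contra hne
    refine hle ?_
    have h1 : ¬ A ⊓ U ≤ B := fun h => hne (le_antisymm
      (by rw [← hC]; exact le_inf h inf_le_right) (by rw [← hC]; exact inf_le_inf_right _ hBA))
    have h2 : B < B ⊔ A ⊓ U := lt_of_le_of_ne le_sup_left fun h => h1 (by
      conv_rhs => rw [h]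
      exact le_sup_right)
    have h3 : B ⊔ A ⊓ U = A := by
      refine Submodule.eq_of_le_of_finrank_le (sup_le hBA inf_le_left) ?_
      have := Submodule.finrank_lt_finrank_of_lt h2
      omega
    rw [← h3]
    exact sup_le_sup_left inf_le_right _

variable [Finite F]

theorem one_lt_natCard_field : (1 : ℝ) < Nat.card F := by
  exact_mod_cast Finite.one_lt_card

instance Submodule.instFiniteOfFiniteField : Finite (Submodule F V) :=
  have : Finite V := Module.finite_of_finite F
  Finite.of_injective _ SetLike.coe_injective

/-- Finite sums over all subspaces of `V` refer to this enumeration. -/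
instance Submodule.instFintypeOfFiniteField : Fintype (Submodule F V) := Fintype.ofFinite _

open Classical in
/-- The subspaces `W` with `H ⊆ W ⊆ Z` whose dimension exceeds that of `H` by one. -/
def covUp (H Z : Submodule F V) : Finset (Submodule F V) :=
  {W | H ≤ W ∧ W ≤ Z ∧ finrank F W = finrank F H + 1}

open Classical in
/-- The subspaces `H` with `B ⊆ H ⊆ W` that are hyperplanes of `W`. -/
def covDown (B W : Submodule F V) : Finset (Submodule F V) :=
  {H | B ≤ H ∧ H ≤ W ∧ finrank F H + 1 = finrank F W}

theorem mem_covUp {H Z W : Submodule F V} :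
    W ∈ covUp H Z ↔ H ≤ W ∧ W ≤ Z ∧ finrank F W = finrank F H + 1 := by
  simp [covUp]

theorem mem_covDown {B W H : Submodule F V} :
    H ∈ covDown B W ↔ B ≤ H ∧ H ≤ W ∧ finrank F H + 1 = finrank F W := by
  simp [covDown]

theorem card_covUp {H Z : Submodule F V} (h : H ≤ Z) :
    ((covUp H Z).card : ℝ) = qInt (Nat.card F) (finrank F Z - finrank F H) := by
  classical
  have : Finite V := Module.finite_of_finite F
  let _ : Fintype V := Fintype.ofFinite V
  set q : ℝ := (Nat.card F : ℝ) with hq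
  have hq1 : 1 < q := one_lt_natCard_field
  -- each vector of `Z` outside `H` spans, together with `H`, exactly one of these subspaces
  have key : (Finset.univ.filter fun v : V => v ∈ Z ∧ v ∉ H).card =
      ∑ W ∈ covUp H Z, (Finset.univ.filter fun v : V => v ∈ W ∧ v ∉ H).card := by
    rw [Finset.card_eq_sum_card_fiberwise (f := fun v => H ⊔ Submodule.span F {v})
      (t := covUp H Z)]
    · refine Finset.sum_congr rfl fun W hW => congrArg _ ?_
      obtain ⟨h1, h2, h3⟩ := mem_covUp.1 hW
      ext v
      simp only [Finset.mem_filter, Finset.mem_univ, true_and]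
      constructor
      · rintro ⟨⟨_, hv⟩, rfl⟩
        exact ⟨Submodule.mem_sup_right (Submodule.mem_span_singleton_self v), hv⟩
      · rintro ⟨hvW, hv⟩
        refine ⟨⟨h2 hvW, hv⟩, Submodule.eq_of_le_of_finrank_eq ?_ ?_⟩
        · exact sup_le h1 (by simpa using hvW)
        · rw [Submodule.finrank_sup_span_singleton hv, h3]
    · intro v hv
      simp only [Finset.coe_filter, Finset.mem_univ, true_and, Set.mem_ofPred_eq] at hv
      exact mem_covUp.2 ⟨le_sup_left, sup_le h (by simpa using hv.1),
        Submodule.finrank_sup_span_singleton hv.2⟩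
  have key' := congrArg (fun n : ℕ => (n : ℝ)) key
  simp only [Nat.cast_sum] at key'
  rw [card_filter_mem_diff h, Finset.sum_congr rfl fun W hW => by
    rw [card_filter_mem_diff (mem_covUp.1 hW).1, (mem_covUp.1 hW).2.2], Finset.sum_const,
    nsmul_eq_mul, ← hq] at key'
  obtain ⟨d, hd⟩ := Nat.exists_eq_add_of_le (Submodule.finrank_mono h)
  rw [hd, Nat.add_sub_cancel_left, qInt_eq_div hq1, eq_div_iff (by linarith)]
  rw [hd, pow_add, pow_succ] at key'
  have : 0 < q ^ finrank F H := pow_pos (by linarith) _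
  refine mul_left_cancel₀ this.ne' ?_
  linarith

theorem card_covDown {B W : Submodule F V} (h : B ≤ W) :
    ((covDown B W).card : ℝ) = qInt (Nat.card F) (finrank F W - finrank F B) := by
  have hfin : ∀ U : Submodule F V, finrank F U + finrank F U.dualAnnihilator = finrank F V :=
    Subspace.finrank_add_finrank_dualAnnihilator_eq
  have hcard : (covDown B W).card = (covUp W.dualAnnihilator B.dualAnnihilator).card := by
    refine Finset.card_bij (fun H _ => H.dualAnnihilator) ?_ ?_ ?_
    · intro H hH
      obtain ⟨h1, h2, h3⟩ := mem_covDown.1 hH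
      refine mem_covUp.2 ⟨Submodule.dualAnnihilator_anti h2, Submodule.dualAnnihilator_anti h1, ?_⟩
      have := hfin H
      have := hfin W
      omega
    · intro H _ H' _ hHH
      exact Subspace.dualAnnihilator_inj.1 hHH
    · intro Y hY
      obtain ⟨h1, h2, h3⟩ := mem_covUp.1 hY
      have hY' : Y.dualCoannihilator.dualAnnihilator = Y :=
        Subspace.dualCoannihilator_dualAnnihilator_eq
      refine ⟨Y.dualCoannihilator, mem_covDown.2 ?_, hY'⟩
      refine ⟨?_, ?_, ?_⟩
      · rw [← Subspace.dualAnnihilator_le_dualAnnihilator_iff, hY']; exact h2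
      · rw [← Subspace.dualAnnihilator_le_dualAnnihilator_iff, hY']; exact h1
      · have := hfin Y.dualCoannihilator
        have := hfin W
        rw [hY'] at *
        omega
  rw [hcard, card_covUp (Submodule.dualAnnihilator_anti h)]
  congr 1
  have := hfin B
  have := hfin W
  have := Submodule.finrank_mono h
  omega

open Classical in
/-- The subspaces `A` with `C ⊆ A ⊆ Z` and `A ∩ U = C` of relative dimension `s` over `C`. -/
def relDisj (C U Z : Submodule F V) (s : ℕ) : Finset (Submodule F V) :=
  {A | C ≤ A ∧ A ≤ Z ∧ finrank F A = finrank F C + s ∧ A ⊓ U = C}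

theorem mem_relDisj {C U Z A : Submodule F V} {s : ℕ} :
    A ∈ relDisj C U Z s ↔ C ≤ A ∧ A ≤ Z ∧ finrank F A = finrank F C + s ∧ A ⊓ U = C := by
  simp [relDisj]

open Classical in
theorem card_covUp_filter_inf_eq {B C U Z : Submodule F V} (hBZ : B ≤ Z) (hUZ : U ≤ Z)
    (hC : B ⊓ U = C) :
    (((covUp B Z).filter fun A => A ⊓ U = C).card : ℝ) =
      qInt (Nat.card F) (finrank F Z - finrank F B) -
        qInt (Nat.card F) (finrank F U - finrank F C) := by
  have h1 : ((covUp B Z).filter fun A => A ⊓ U = C) = covUp B Z \ covUp B (B ⊔ U) := by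
    ext A
    simp only [Finset.mem_filter, Finset.mem_sdiff, mem_covUp]
    constructor
    · rintro ⟨⟨h1, h2, h3⟩, h4⟩
      exact ⟨⟨h1, h2, h3⟩, fun h => (inf_eq_iff_not_le_sup h1 h3 hC).1 h4 h.2.1⟩
    · rintro ⟨⟨h1, h2, h3⟩, h4⟩
      exact ⟨⟨h1, h2, h3⟩, (inf_eq_iff_not_le_sup h1 h3 hC).2 fun h => h4 ⟨h1, h, h3⟩⟩
  have h2 : covUp B (B ⊔ U) ⊆ covUp B Z := by
    intro A hA
    rw [mem_covUp] at hA ⊢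
    exact ⟨hA.1, hA.2.1.trans (sup_le hBZ hUZ), hA.2.2⟩
  rw [h1, Finset.cast_card_sdiff h2, card_covUp hBZ, card_covUp le_sup_left]
  have := Submodule.finrank_sup_add_finrank_inf_eq B U
  rw [hC] at this
  congr 2
  omega

/-- Two-step double counting over flags `B ⊂ A` gives the number of subspaces `A` between `C` and
`Z` that meet `U` in `C`. -/
theorem card_relDisj {C U Z : Submodule F V} (hCU : C ≤ U) (hUZ : U ≤ Z) (s : ℕ) :
    ((relDisj C U Z s).card : ℝ) = ∏ j ∈ Finset.range s,
      (qInt (Nat.card F) (finrank F Z - finrank F C - j) -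
        qInt (Nat.card F) (finrank F U - finrank F C)) / qInt (Nat.card F) (j + 1) := by
  classical
  induction s with
  | zero =>
    have : relDisj C U Z 0 = {C} := by
      ext A
      rw [mem_relDisj, Finset.mem_singleton]
      constructor
      · rintro ⟨h1, _, h3, _⟩
        exact (Submodule.eq_of_le_of_finrank_eq h1 (by omega)).symm
      · rintro rfl
        exact ⟨le_rfl, hCU.trans hUZ, rfl, inf_eq_left.2 hCU⟩
    simp [this]
  | succ s ih =>
    have hq1 : (1 : ℝ) < Nat.card F := one_lt_natCard_field
    rw [Finset.prod_range_succ, ← ih, mul_div_assoc', eq_div_iff (qInt_pos hq1 s.succ_pos).ne']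
    have key := Finset.sum_card_bipartiteAbove_eq_sum_card_bipartiteBelow
      (s := relDisj C U Z s) (t := relDisj C U Z (s + 1)) (fun B A : Submodule F V => B ≤ A)
    have key' := congrArg (fun n : ℕ => (n : ℝ)) key
    simp only [Nat.cast_sum] at key'
    rw [Finset.sum_congr rfl (g := fun _ =>
        (qInt (Nat.card F) (finrank F Z - finrank F C - s) -
          qInt (Nat.card F) (finrank F U - finrank F C))), Finset.sum_const, nsmul_eq_mul,
      Finset.sum_congr (s₁ := relDisj C U Z (s + 1)) rfl
        (g := fun _ => qInt (Nat.card F) (s + 1)), Finset.sum_const, nsmul_eq_mul] at key'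
    · exact key'.symm
    · intro A hA
      obtain ⟨h1, h2, h3, h4⟩ := mem_relDisj.1 hA
      have : Finset.bipartiteBelow (fun B A : Submodule F V => B ≤ A) (relDisj C U Z s) A =
          covDown C A := by
        ext B
        rw [Finset.mem_bipartiteBelow, mem_relDisj, mem_covDown]
        constructor
        · rintro ⟨⟨h5, h6, h7, h8⟩, h9⟩
          exact ⟨h5, h9, by omega⟩
        · rintro ⟨h5, h6, h7⟩
          refine ⟨⟨h5, h6.trans h2, by omega, le_antisymm ?_ (le_inf h5 hCU)⟩, h6⟩
          rw [← h4]
          exact inf_le_inf_right _ h6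
      rw [this, card_covDown h1, h3, Nat.add_sub_cancel_left]
    · intro B hB
      obtain ⟨h1, h2, h3, h4⟩ := mem_relDisj.1 hB
      have : Finset.bipartiteAbove (fun B A : Submodule F V => B ≤ A) (relDisj C U Z (s + 1)) B =
          (covUp B Z).filter fun A => A ⊓ U = C := by
        ext A
        rw [Finset.mem_bipartiteAbove, mem_relDisj, Finset.mem_filter, mem_covUp]
        constructor
        · rintro ⟨⟨h5, h6, h7, h8⟩, h9⟩
          exact ⟨⟨h9, h6, by omega⟩, h8⟩
        · rintro ⟨⟨h5, h6, h7⟩, h8⟩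
          exact ⟨⟨h1.trans h5, h6, by omega, h8⟩, h5⟩
      rw [this, card_covUp_filter_inf_eq h2 hUZ h4, h3, Nat.sub_add_eq]

end Counting

end

noncomputable section

/-! ### Up and down operators on indicator functions of subspaces -/

section UpDown

open Module

variable {F : Type*} [Field F] {V : Type*} [AddCommGroup V] [Module F V]

open Classical in
/-- The indicator function of the subspaces containing `A`. -/
def supInd (A W : Submodule F V) : ℝ := if A ≤ W then 1 else 0

open Classical in
/-- The indicator function of the subspaces meeting `A` trivially. -/
def disjInd (A W : Submodule F V) : ℝ := if A ⊓ W = ⊥ then 1 else 0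

theorem upFun_eq_supInd (m : ℕ) (A : Submodule F V) (W : Gr F V m) :
    upFun m A W = (supInd A W.1 : ℂ) := by
  unfold upFun supInd; split_ifs <;> simp

variable [Finite F] [FiniteDimensional F V]

theorem sum_covDown_supInd (A W : Submodule F V) :
    ∑ H ∈ covDown ⊥ W, supInd A H =
      qInt (Nat.card F) (finrank F W - finrank F A) * supInd A W := by
  classical
  unfold supInd
  rw [Finset.sum_boole]
  split_ifs with h
  · rw [mul_one, ← card_covDown h]
    congr 2
    ext H
    simp only [Finset.mem_filter, mem_covDown, bot_le, true_and]
    tauto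
  · rw [mul_zero, Nat.cast_eq_zero, Finset.card_eq_zero, Finset.filter_eq_empty_iff]
    exact fun H hH hA => h (hA.trans (mem_covDown.1 hH).2.1)

theorem sum_covUp_supInd (A H : Submodule F V) :
    ∑ W ∈ covUp H ⊤, supInd A W =
      (qInt (Nat.card F) (finrank F V - finrank F H) - qInt (Nat.card F) (finrank F A)) *
        supInd A H + ∑ B ∈ covDown ⊥ A, supInd B H := by
  classical
  unfold supInd
  rw [Finset.sum_boole, Finset.sum_boole]
  by_cases h : A ≤ H
  · rw [if_pos h, Finset.filter_true_of_mem fun W hW => h.trans (mem_covUp.1 hW).1,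
      Finset.filter_true_of_mem fun B hB => (mem_covDown.1 hB).2.1.trans h,
      card_covUp le_top, card_covDown bot_le, finrank_top, finrank_bot, Nat.sub_zero]
    ring
  · rw [if_neg h, mul_zero, zero_add]
    have hdim := Submodule.finrank_sup_add_finrank_inf_eq H A
    -- both counts are one if `A ∩ H` is a hyperplane of `A`, and zero otherwise
    by_cases hc : finrank F ↥(H ⊓ A) + 1 = finrank F A
    · have h1 : (covUp H ⊤).filter (fun W => A ≤ W) = {H ⊔ A} := by
        ext W
        simp only [Finset.mem_filter, mem_covUp, Finset.mem_singleton, le_top, true_and]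
        constructor
        · rintro ⟨⟨h1, h2⟩, h3⟩
          exact (Submodule.eq_of_le_of_finrank_eq (sup_le h1 h3) (by omega)).symm
        · rintro rfl
          exact ⟨⟨le_sup_left, by omega⟩, le_sup_right⟩
      have h2 : (covDown ⊥ A).filter (fun B => B ≤ H) = {H ⊓ A} := by
        ext B
        simp only [Finset.mem_filter, mem_covDown, Finset.mem_singleton, bot_le, true_and]
        constructor
        · rintro ⟨⟨h1, h2⟩, h3⟩
          exact Submodule.eq_of_le_of_finrank_eq (le_inf h3 h1) (by omega)
        · rintro rfl
          exact ⟨⟨inf_le_right, by omega⟩, inf_le_left⟩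
      rw [h1, h2, Finset.card_singleton, Finset.card_singleton]
    · have hlt : finrank F ↥(H ⊓ A) < finrank F A :=
        Submodule.finrank_lt_finrank_of_lt (lt_of_le_of_ne inf_le_right fun h' => h
          (by rw [← h']; exact inf_le_left))
      rw [Finset.filter_eq_empty_iff.2, Finset.filter_eq_empty_iff.2]
      · intro B hB hBH
        obtain ⟨-, h1, h2⟩ := mem_covDown.1 hB
        have := Submodule.finrank_mono (le_inf hBH h1)
        omega
      · intro W hW hAW
        obtain ⟨h1, -, h2⟩ := mem_covUp.1 hW
        have := Submodule.finrank_mono (sup_le h1 hAW)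
        omega

theorem sum_covUp_disjInd (A H : Submodule F V) :
    ∑ W ∈ covUp H ⊤, disjInd A W =
      (qInt (Nat.card F) (finrank F V - finrank F H) - qInt (Nat.card F) (finrank F A)) *
        disjInd A H := by
  classical
  unfold disjInd
  rw [Finset.sum_boole]
  split_ifs with h
  · have := card_covUp_filter_inf_eq (B := H) (U := A) (Z := ⊤) le_top le_top
      (by rw [inf_comm, h])
    simp only [inf_comm A]
    rw [this, finrank_top, finrank_bot, Nat.sub_zero, mul_one]
  · rw [mul_zero, Nat.cast_eq_zero, Finset.card_eq_zero, Finset.filter_eq_empty_iff]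
    exact fun W hW hA => h (le_bot_iff.1 ((inf_le_inf_left A (mem_covUp.1 hW).1).trans hA.le))

open Classical in
/-- The number of hyperplanes of `W` that meet the subspace `C` trivially. -/
theorem card_covDown_filter_inf_eq_bot {C W : Submodule F V} (h : C ≤ W) :
    (((covDown ⊥ W).filter fun H => C ⊓ H = ⊥).card : ℝ) =
      if finrank F C = 0 then qInt (Nat.card F) (finrank F W) else
        if finrank F C = 1 then (Nat.card F : ℝ) ^ (finrank F W - 1) else 0 := by
  split_ifs with h0 h1
  · rw [Finset.filter_true_of_mem, card_covDown bot_le, finrank_bot, Nat.sub_zero]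
    intro H _
    rw [Submodule.finrank_eq_zero.1 h0, bot_inf_eq]
  · have hs : ((covDown ⊥ W).filter fun H => C ⊓ H = ⊥) = covDown ⊥ W \ covDown C W := by
      ext H
      simp only [Finset.mem_filter, Finset.mem_sdiff, mem_covDown, bot_le, true_and]
      refine and_congr_right fun hH => ?_
      constructor
      · rintro hb ⟨hC, -⟩
        rw [inf_eq_left.2 hC] at hb
        rw [hb, finrank_bot] at h1
        omega
      · intro hC
        by_contra hb
        have h2 : 0 < finrank F ↥(C ⊓ H) := Nat.pos_of_ne_zero fun h' =>
          hb (Submodule.finrank_eq_zero.1 h')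
        have h3 : C ⊓ H = C := Submodule.eq_of_le_of_finrank_le inf_le_left (by omega)
        exact hC ⟨inf_eq_left.1 h3, hH⟩
    have hsub : covDown C W ⊆ covDown ⊥ W := by
      intro H hH
      rw [mem_covDown] at hH ⊢
      exact ⟨bot_le, hH.2⟩
    rw [hs, Finset.cast_card_sdiff hsub, card_covDown bot_le, card_covDown h, finrank_bot, h1,
      Nat.sub_zero]
    have : 1 ≤ finrank F W := h1 ▸ Submodule.finrank_mono h
    obtain ⟨w, hw⟩ := Nat.exists_eq_add_of_le' this
    rw [hw, Nat.add_sub_cancel, qInt_succ]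
    ring
  · rw [Nat.cast_eq_zero, Finset.card_eq_zero, Finset.filter_eq_empty_iff]
    intro H hH hb
    obtain ⟨-, h2, h3⟩ := mem_covDown.1 hH
    have := Submodule.finrank_sup_add_finrank_inf_eq C H
    rw [hb, finrank_bot] at this
    have := Submodule.finrank_mono (sup_le h h2)
    omega

theorem sum_covDown_disjInd {A W : Submodule F V} (h : finrank F A ≤ finrank F W) :
    ∑ H ∈ covDown ⊥ W, disjInd A H =
      qInt (Nat.card F) (finrank F W - finrank F A) * disjInd A W +
        (Nat.card F : ℝ) ^ (finrank F W - finrank F A) * ∑ B ∈ covDown ⊥ A, disjInd B W := by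
  classical
  unfold disjInd
  rw [Finset.sum_boole, Finset.sum_boole]
  have h1 : ((covDown ⊥ W).filter fun H => A ⊓ H = ⊥) =
      (covDown ⊥ W).filter fun H => (A ⊓ W) ⊓ H = ⊥ := by
    refine Finset.filter_congr fun H hH => ?_
    rw [inf_assoc, inf_eq_right.2 (mem_covDown.1 hH).2.1]
  have h2 : ((covDown ⊥ A).filter fun B => B ⊓ W = ⊥) =
      (covDown ⊥ A).filter fun B => (A ⊓ W) ⊓ B = ⊥ := by
    refine Finset.filter_congr fun B hB => ?_
    rw [inf_right_comm, inf_eq_right.2 (mem_covDown.1 hB).2.1]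
  rw [h1, h2, card_covDown_filter_inf_eq_bot inf_le_right,
    card_covDown_filter_inf_eq_bot inf_le_left]
  obtain ⟨d, hd⟩ := Nat.exists_eq_add_of_le h
  rw [hd, Nat.add_sub_cancel_left]
  by_cases h0 : finrank F ↥(A ⊓ W) = 0
  · rw [if_pos h0, if_pos h0, if_pos (Submodule.finrank_eq_zero.1 h0), add_comm, qInt_add, mul_one]
  · have hb : ¬ A ⊓ W = ⊥ := fun h' => h0 (by rw [h', finrank_bot])
    rw [if_neg h0, if_neg h0, if_neg hb, mul_zero, zero_add]
    split_ifs with h3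
    · have : finrank F ↥(A ⊓ W) ≤ finrank F A := Submodule.finrank_mono inf_le_left
      rw [← pow_add]
      congr 1
      omega
    · rw [mul_zero]

/-- The composition of a down step and an up step, on functions of subspaces. -/
def downUp (f : Submodule F V → ℝ) (W : Submodule F V) : ℝ :=
  ∑ H ∈ covDown ⊥ W, ∑ W' ∈ covUp H ⊤, f W'

theorem finrank_of_mem_covDown {B W H : Submodule F V} (h : H ∈ covDown B W) :
    finrank F V - finrank F H = finrank F V + 1 - finrank F W := by
  have := (mem_covDown.1 h).2.2
  omega

theorem downUp_supInd {A W : Submodule F V} (h : finrank F A ≤ finrank F W) :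
    downUp (supInd A) W =
      (qInt (Nat.card F) (finrank F V + 1 - finrank F W) - qInt (Nat.card F) (finrank F A)) *
        qInt (Nat.card F) (finrank F W - finrank F A) * supInd A W +
      qInt (Nat.card F) (finrank F W - finrank F A + 1) * ∑ B ∈ covDown ⊥ A, supInd B W := by
  unfold downUp
  simp only [sum_covUp_supInd]
  rw [Finset.sum_add_distrib, Finset.sum_comm, Finset.sum_congr rfl fun H hH => by
    rw [finrank_of_mem_covDown hH], ← Finset.mul_sum, sum_covDown_supInd, ← mul_assoc,
    Finset.mul_sum]
  congr 1
  refine Finset.sum_congr rfl fun B hB => ?_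
  rw [sum_covDown_supInd]
  have := (mem_covDown.1 hB).2.2
  congr 2
  omega

theorem downUp_disjInd {A W : Submodule F V} (h : finrank F A ≤ finrank F W) :
    downUp (disjInd A) W =
      (qInt (Nat.card F) (finrank F V + 1 - finrank F W) - qInt (Nat.card F) (finrank F A)) *
      (qInt (Nat.card F) (finrank F W - finrank F A) * disjInd A W +
        (Nat.card F : ℝ) ^ (finrank F W - finrank F A) * ∑ B ∈ covDown ⊥ A, disjInd B W) := by
  unfold downUp
  simp only [sum_covUp_disjInd]
  rw [Finset.sum_congr rfl fun H hH => by rw [finrank_of_mem_covDown hH], ← Finset.mul_sum,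
    sum_covDown_disjInd h]

end UpDown

end

noncomputable section

/-! ### The adjacency operator and the decomposition of `1_K^G` -/

section Decomposition

open Module

theorem prod_qInt_div_eq_qBinom {q : ℝ} (hq : 1 < q) (a s : ℕ) :
    ∏ j ∈ Finset.range s, qInt q (a - j) / qInt q (j + 1) = qBinom q a s := by
  unfold qBinom
  split_ifs with h
  · obtain ⟨b, rfl⟩ := Nat.exists_eq_add_of_le' h
    rw [Nat.add_sub_cancel, Finset.prod_div_distrib, mul_comm, ← div_div]
    have h2 : qFact q (b + s) = (∏ j ∈ Finset.range s, qInt q (b + s - j)) * qFact q b := by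
      rw [qFact, Finset.prod_range_add, mul_comm, ← qFact, ← Finset.prod_range_reflect]
      congr 1
      refine Finset.prod_congr rfl fun j hj => ?_
      rw [Finset.mem_range] at hj
      congr 1
      omega
    rw [h2, mul_div_cancel_right₀ _ (qFact_pos hq b).ne']
    rfl
  · rw [not_le] at h
    exact Finset.prod_eq_zero (Finset.mem_range.2 h) (by rw [Nat.sub_self, qInt_zero, zero_div])

theorem qBinom_pos {q : ℝ} (hq : 1 < q) {a s : ℕ} (h : s ≤ a) : 0 < qBinom q a s := by
  rw [qBinom, if_pos h]
  exact div_pos (qFact_pos hq _) (mul_pos (qFact_pos hq _) (qFact_pos hq _))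

theorem exists_mem_orthogonal_sub {ι : Type*} [Fintype ι] (K : Submodule ℂ (ι → ℂ)) (f : ι → ℂ) :
    ∃ g ∈ K, ∀ u ∈ K, ∑ i, conj (u i) * (f - g) i = 0 := by
  let e := (WithLp.linearEquiv 2 ℂ (ι → ℂ)).symm
  let K' : Submodule ℂ (EuclideanSpace ℂ ι) := K.map e.toLinearMap
  obtain ⟨g, hg, hge⟩ : K'.starProjection (e f) ∈ K' := Submodule.starProjection_apply_mem _ _
  refine ⟨g, hg, fun u hu => ?_⟩
  have h := K'.sub_starProjection_mem_orthogonal (e f)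
  rw [← hge, Submodule.mem_orthogonal] at h
  have h' := h (e u) ⟨u, hu, rfl⟩
  rw [PiLp.inner_apply] at h'
  rw [← h']
  refine Finset.sum_congr rfl fun i _ => ?_
  simp [e, mul_comm]

theorem eq_zero_of_sum_conj_mul_self {ι : Type*} [Fintype ι] {u : ι → ℂ}
    (h : ∑ i, conj (u i) * u i = 0) : u = 0 := by
  have h1 : ∑ i, Complex.normSq (u i) = 0 := by
    have : ((∑ i, Complex.normSq (u i) : ℝ) : ℂ) = 0 := by
      rw [← h]
      simp only [Complex.ofReal_sum, Complex.normSq_eq_conj_mul_self]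
    exact_mod_cast this
  rw [Finset.sum_eq_zero_iff_of_nonneg fun i _ => Complex.normSq_nonneg _] at h1
  ext i
  simpa using h1 i (Finset.mem_univ i)

variable {F : Type*} [Field F] {V : Type*} [AddCommGroup V] [Module F V]

variable (F V) in
/-- The span `U_x` of the indicator functions of the sets of `W` containing a given
`x`-dimensional subspace. -/
def upSpan (m x : ℕ) : Submodule ℂ (Gr F V m → ℂ) :=
  Submodule.span ℂ (Set.range fun A : Gr F V x => upFun m A.1)

variable (F V) in
/-- The sum of the spaces `U_y` for `y < x`. -/
def lowSpan (m x : ℕ) : Submodule ℂ (Gr F V m → ℂ) :=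
  Submodule.span ℂ (upFun m '' {B | finrank F B < x})

theorem upFun_mem_lowSpan {m x : ℕ} {B : Submodule F V} (h : finrank F B < x) :
    upFun m B ∈ lowSpan F V m x := Submodule.subset_span ⟨B, h, rfl⟩

theorem upFun_mem_upSpan {m x : ℕ} {A : Submodule F V} (h : finrank F A = x) :
    upFun m A ∈ upSpan F V m x := Submodule.subset_span ⟨⟨A, h⟩, rfl⟩

theorem conj_upFun (m : ℕ) (B : Submodule F V) (W : Gr F V m) :
    conj (upFun m B W) = upFun m B W := by
  rw [upFun_eq_supInd, Complex.conj_ofReal]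

theorem lowSpan_zero (m : ℕ) : lowSpan F V m 0 = ⊥ := by simp [lowSpan]

theorem lowSpan_succ (m x : ℕ) :
    lowSpan F V m (x + 1) = lowSpan F V m x ⊔ upSpan F V m x := by
  rw [lowSpan, lowSpan, upSpan, ← Submodule.span_union]
  congr 1
  ext f
  constructor
  · rintro ⟨B, hB, rfl⟩
    rcases Nat.lt_succ_iff_lt_or_eq.1 hB with h | h
    · exact Or.inl ⟨B, h, rfl⟩
    · exact Or.inr ⟨⟨B, h⟩, rfl⟩
  · rintro (⟨B, hB, rfl⟩ | ⟨A, rfl⟩)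
    · exact ⟨B, Nat.lt_succ_of_lt hB, rfl⟩
    · exact ⟨A.1, by rw [Set.mem_ofPred_eq, A.2]; exact Nat.lt_succ_self x, rfl⟩

variable [Finite F] [FiniteDimensional F V]

variable (F V) in
open Classical in
/-- The `m`-dimensional subspaces of `V`, as a finite set of subspaces. -/
def subspacesOfDim (m : ℕ) : Finset (Submodule F V) := {W | finrank F W = m}

theorem mem_subspacesOfDim {m : ℕ} {W : Submodule F V} :
    W ∈ subspacesOfDim F V m ↔ finrank F W = m := by
  simp [subspacesOfDim]

theorem sum_Gr_eq {M : Type*} [AddCommMonoid M] (m : ℕ) (φ : Submodule F V → M) :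
    ∑ W : Gr F V m, φ W.1 = ∑ W ∈ subspacesOfDim F V m, φ W := by
  refine Finset.sum_bij (fun W _ => W.1) ?_ ?_ ?_ ?_
  · intro W _; exact mem_subspacesOfDim.2 W.2
  · intro W _ W' _ h; exact Subtype.ext h
  · intro W hW; exact ⟨⟨W, mem_subspacesOfDim.1 hW⟩, Finset.mem_univ _, rfl⟩
  · intro W _; rfl

theorem card_Gr (m : ℕ) :
    (Fintype.card (Gr F V m) : ℝ) = qBinom (Nat.card F) (finrank F V) m := by
  have h := card_relDisj (F := F) (V := V) (C := ⊥) (U := ⊥) (Z := ⊤) le_rfl le_top m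
  simp only [finrank_top, finrank_bot, Nat.sub_zero, qInt_zero, sub_zero] at h
  rw [prod_qInt_div_eq_qBinom one_lt_natCard_field] at h
  rw [← h, Fintype.card_eq_sum_ones, sum_Gr_eq m (fun _ => 1), Finset.sum_const, smul_eq_mul,
    mul_one]
  congr 2
  ext A
  simp [mem_relDisj, mem_subspacesOfDim]

/-- The number of common hyperplanes of two subspaces. -/
def adjKer {m : ℕ} (W W' : Gr F V m) : ℂ := by
  classical exact ((covDown ⊥ W.1 ∩ covDown ⊥ W'.1).card : ℂ)

variable (F V) in
/-- The operator on functions on `Gr(m,n)` with kernel `adjKer`. It equals the adjacency operator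
of the Grassmann graph up to a multiple of the identity. -/
def adjOp (m : ℕ) : (Gr F V m → ℂ) →ₗ[ℂ] (Gr F V m → ℂ) where
  toFun f W := ∑ W', adjKer W W' * f W'
  map_add' f g := by ext W; simp [mul_add, Finset.sum_add_distrib]
  map_smul' c f := by ext W; simp [Finset.mul_sum, mul_left_comm]

theorem adjOp_apply {m : ℕ} (f : Gr F V m → ℂ) (W : Gr F V m) :
    adjOp F V m f W = ∑ W', adjKer W W' * f W' := rfl

theorem adjKer_comm {m : ℕ} (W W' : Gr F V m) : adjKer W W' = adjKer W' W := by
  classical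
  unfold adjKer
  rw [Finset.inter_comm]

theorem conj_adjKer {m : ℕ} (W W' : Gr F V m) : conj (adjKer W W') = adjKer W W' := by
  unfold adjKer
  exact map_natCast _ _

theorem sum_conj_adjOp_mul {m : ℕ} (f g : Gr F V m → ℂ) :
    ∑ W, conj (adjOp F V m f W) * g W = ∑ W, conj (f W) * adjOp F V m g W := by
  simp only [adjOp_apply, map_sum, map_mul, Finset.sum_mul, Finset.mul_sum, conj_adjKer]
  rw [Finset.sum_comm]
  refine Finset.sum_congr rfl fun W _ => Finset.sum_congr rfl fun W' _ => ?_
  rw [adjKer_comm]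
  ring

theorem adjOp_ofReal {m : ℕ} (φ : Submodule F V → ℝ) (W : Gr F V m) :
    adjOp F V m (fun W => (φ W.1 : ℂ)) W = (downUp φ W.1 : ℂ) := by
  classical
  have h1 : ∀ W' : Gr F V m, adjKer W W' * (φ W'.1 : ℂ) =
      ((∑ H ∈ covDown ⊥ W.1, if H ∈ covDown ⊥ W'.1 then φ W'.1 else 0 : ℝ) : ℂ) := fun W' => by
    rw [← Finset.sum_filter, Finset.filter_mem_eq_inter, Finset.sum_const, nsmul_eq_mul]
    push_cast
    rfl
  rw [adjOp_apply]
  simp only [h1]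
  rw [← Complex.ofReal_sum, Finset.sum_comm, downUp]
  refine congrArg _ (Finset.sum_congr rfl fun H hH => ?_)
  rw [sum_Gr_eq m fun W' => if H ∈ covDown ⊥ W' then φ W' else 0, ← Finset.sum_filter]
  refine Finset.sum_congr ?_ fun _ _ => rfl
  ext W'
  have := (mem_covDown.1 hH).2.2
  have hW := W.2
  simp only [Finset.mem_filter, mem_subspacesOfDim, true_and, mem_covDown, mem_covUp, bot_le, le_top]
  constructor
  · rintro ⟨_, h2, h3⟩; exact ⟨h2, h3.symm⟩
  · rintro ⟨h2, h3⟩; exact ⟨by omega, h2, h3.symm⟩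

/-- The eigenvalue of `adjOp` on the constituent `V_x`. -/
def adjEig (q : ℝ) (n m x : ℕ) : ℝ := (qInt q (n + 1 - m) - qInt q x) * qInt q (m - x)

theorem adjEig_lt {q : ℝ} (hq : 1 < q) {n m x y : ℕ} (hm : 2 * m ≤ n) (hxy : x < y)
    (hy : y ≤ m) : adjEig q n m y < adjEig q n m x := by
  have h := qInt_strictMono hq
  have h1 : qInt q y < qInt q (n + 1 - m) := h (by omega)
  have h2 : qInt q x < qInt q y := h hxy
  have h3 : qInt q (m - y) < qInt q (m - x) := h (by omega)
  have h4 : 0 ≤ qInt q (m - y) := by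
    rw [← qInt_zero (q := q)]; exact h.monotone (Nat.zero_le _)
  unfold adjEig
  nlinarith

theorem adjEig_injOn {q : ℝ} (hq : 1 < q) {n m x y : ℕ} (hm : 2 * m ≤ n) (hx : x ≤ m)
    (hy : y ≤ m) (h : adjEig q n m x = adjEig q n m y) : x = y := by
  rcases lt_trichotomy x y with h' | h' | h'
  · exact absurd h (adjEig_lt hq hm h' hy).ne'
  · exact h'
  · exact absurd h (adjEig_lt hq hm h' hx).ne

theorem adjOp_upFun {m : ℕ} {A : Submodule F V} (hA : finrank F A ≤ m) :
    adjOp F V m (upFun m A) =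
      (adjEig (Nat.card F) (finrank F V) m (finrank F A) : ℂ) • upFun m A +
      (qInt (Nat.card F) (m - finrank F A + 1) : ℂ) • ∑ B ∈ covDown ⊥ A, upFun m B := by
  have h1 : upFun m A = fun W => (supInd A W.1 : ℂ) := funext fun W => upFun_eq_supInd m A W
  ext W
  rw [h1, adjOp_ofReal, downUp_supInd (by rw [W.2]; exact hA), W.2, ← adjEig]
  simp [upFun_eq_supInd]

theorem mem_irrepV {m x : ℕ} {f : Gr F V m → ℂ} :
    f ∈ (irrepV F V m x).toSubmodule ↔ f ∈ upSpan F V m x ∧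
      ∀ B : Submodule F V, finrank F B < x → ∑ W : Gr F V m, upFun m B W * f W = 0 := Iff.rfl

theorem sum_conj_mul_eq_zero_iff {m x : ℕ} {f : Gr F V m → ℂ} :
    (∀ B : Submodule F V, finrank F B < x → ∑ W : Gr F V m, upFun m B W * f W = 0) ↔
      ∀ u ∈ lowSpan F V m x, ∑ W, conj (u W) * f W = 0 := by
  constructor
  · intro h u hu
    induction hu using Submodule.span_induction with
    | mem u hu =>
      obtain ⟨B, hB, rfl⟩ := hu
      simpa only [conj_upFun] using h B hB
    | zero => simp
    | add u v _ _ hu hv => simp [add_mul, Finset.sum_add_distrib, hu, hv]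
    | smul c u _ hu => simp [mul_assoc, ← Finset.mul_sum, hu]
  · intro h B hB
    simpa only [conj_upFun] using h _ (upFun_mem_lowSpan hB)

theorem upFun_mem_upSpan_of_le {m x : ℕ} {B : Submodule F V} (hB : finrank F B ≤ x)
    (hx : x ≤ m) : upFun m B ∈ upSpan F V m x := by
  classical
  have hq : (1 : ℝ) < Nat.card F := one_lt_natCard_field
  set c : ℝ := qBinom (Nat.card F) (m - finrank F B) (x - finrank F B) with hc
  have hc0 : c ≠ 0 := (qBinom_pos hq (by omega)).ne'
  -- every `W` containing `B` contains the same number `c` of `x`-dimensional `A` containing `B`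
  have key : (c : ℂ) • upFun m B =
      ∑ A : Submodule F V with (B ≤ A ∧ finrank F A = x), upFun m A := by
    ext W
    rw [Finset.sum_apply]
    simp only [upFun_eq_supInd, Pi.smul_apply, smul_eq_mul]
    rw [← Complex.ofReal_sum, ← Complex.ofReal_mul]
    refine congrArg _ ?_
    unfold supInd
    rw [Finset.sum_boole, Finset.filter_filter]
    split_ifs with h
    · have h2 := card_relDisj (C := B) (U := B) (Z := W.1) le_rfl h (x - finrank F B)
      simp only [Nat.sub_self, qInt_zero, sub_zero] at h2
      rw [prod_qInt_div_eq_qBinom hq, W.2] at h2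
      rw [mul_one, hc, ← h2]
      congr 2
      ext A
      simp only [Finset.mem_filter, Finset.mem_univ, true_and, mem_relDisj, inf_eq_right]
      rw [Nat.add_sub_cancel' hB]
      tauto
    · rw [mul_zero, eq_comm, Nat.cast_eq_zero, Finset.card_eq_zero, Finset.filter_eq_empty_iff]
      exact fun A _ hA => h (hA.1.1.trans hA.2)
  have h3 : upFun m B = (c : ℂ)⁻¹ • ∑ A : Submodule F V with (B ≤ A ∧ finrank F A = x), upFun m A := by
    rw [← key, inv_smul_smul₀ (by exact_mod_cast hc0)]
  rw [h3]
  refine Submodule.smul_mem _ _ (Submodule.sum_mem _ fun A hA => ?_)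
  exact upFun_mem_upSpan (Finset.mem_filter.1 hA).2.2

theorem lowSpan_le_upSpan {m x : ℕ} (hx : x ≤ m) : lowSpan F V m x ≤ upSpan F V m x := by
  refine Submodule.span_le.2 ?_
  rintro _ ⟨B, hB, rfl⟩
  exact upFun_mem_upSpan_of_le (le_of_lt hB) hx

theorem lowSpan_succ_eq_upSpan {m x : ℕ} (hx : x ≤ m) :
    lowSpan F V m (x + 1) = upSpan F V m x := by
  rw [lowSpan_succ, sup_eq_right.2 (lowSpan_le_upSpan hx)]

theorem upSpan_self (m : ℕ) : upSpan F V m m = ⊤ := by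
  classical
  rw [eq_top_iff]
  intro f _
  have h : f = ∑ W : Gr F V m, f W • upFun m W.1 := by
    ext W
    rw [Finset.sum_apply, Finset.sum_eq_single W]
    · simp [upFun]
    · intro W' _ hne
      have : ¬ W'.1 ≤ W.1 := fun h => hne (Subtype.ext
        (Submodule.eq_of_le_of_finrank_eq h (W'.2.trans W.2.symm)))
      simp [upFun, this]
    · simp
  rw [h]
  exact Submodule.sum_mem _ fun W _ => Submodule.smul_mem _ _ (upFun_mem_upSpan W.2)

theorem adjOp_sub_mem_lowSpan {m x : ℕ} (hx : x ≤ m) {f : Gr F V m → ℂ}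
    (hf : f ∈ upSpan F V m x) :
    adjOp F V m f - (adjEig (Nat.card F) (finrank F V) m x : ℂ) • f ∈ lowSpan F V m x := by
  induction hf using Submodule.span_induction with
  | mem u hu =>
    obtain ⟨A, rfl⟩ := hu
    rw [adjOp_upFun (by rw [A.2]; exact hx), A.2, add_sub_cancel_left]
    refine Submodule.smul_mem _ _ (Submodule.sum_mem _ fun B hB => upFun_mem_lowSpan ?_)
    have := (mem_covDown.1 hB).2.2
    have := A.2
    omega
  | zero => simp
  | add u v _ _ hu hv =>
    rw [map_add, smul_add, add_sub_add_comm]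
    exact Submodule.add_mem _ hu hv
  | smul c u _ hu =>
    rw [map_smul, smul_comm, ← smul_sub]
    exact Submodule.smul_mem _ _ hu

theorem adjOp_mem_lowSpan {m x : ℕ} (hx : x ≤ m + 1) {f : Gr F V m → ℂ}
    (hf : f ∈ lowSpan F V m x) : adjOp F V m f ∈ lowSpan F V m x := by
  cases x with
  | zero =>
    rw [lowSpan_zero, Submodule.mem_bot] at hf
    rw [hf, map_zero]
    exact Submodule.zero_mem _
  | succ x =>
    rw [lowSpan_succ_eq_upSpan (by omega)] at hf ⊢
    have h := lowSpan_le_upSpan (by omega) (adjOp_sub_mem_lowSpan (by omega) hf)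
    simpa using Submodule.add_mem _ h
      (Submodule.smul_mem _ (adjEig (Nat.card F) (finrank F V) m x : ℂ) hf)

/-- `A - η_x` maps `V_x` into `U_{x-1}`, and, being symmetric, also into the orthogonal complement
of `U_{x-1}`. -/
theorem adjOp_of_mem_irrepV {m x : ℕ} (hx : x ≤ m) {f : Gr F V m → ℂ}
    (hf : f ∈ (irrepV F V m x).toSubmodule) :
    adjOp F V m f = (adjEig (Nat.card F) (finrank F V) m x : ℂ) • f := by
  obtain ⟨h1, h2⟩ := mem_irrepV.1 hf
  rw [sum_conj_mul_eq_zero_iff] at h2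
  set η := (adjEig (Nat.card F) (finrank F V) m x : ℂ)
  set u := adjOp F V m f - η • f with hu
  have hmem : u ∈ lowSpan F V m x := adjOp_sub_mem_lowSpan hx h1
  have horth : ∑ W, conj (u W) * u W = 0 := by
    calc ∑ W, conj (u W) * u W
        = ∑ W, conj (u W) * adjOp F V m f W - η * ∑ W, conj (u W) * f W := by
          rw [Finset.mul_sum, ← Finset.sum_sub_distrib]
          refine Finset.sum_congr rfl fun W _ => ?_
          rw [hu]
          simp only [Pi.sub_apply, Pi.smul_apply, smul_eq_mul]
          ring
      _ = 0 := by
          rw [← sum_conj_adjOp_mul, h2 _ (adjOp_mem_lowSpan (by omega) hmem), h2 _ hmem]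
          simp
  have h0 : u = 0 := eq_zero_of_sum_conj_mul_self horth
  rwa [hu, sub_eq_zero] at h0

theorem sup_irrepV {m x : ℕ} (hx : x ≤ m) :
    lowSpan F V m x ⊔ (irrepV F V m x).toSubmodule = upSpan F V m x := by
  refine le_antisymm (sup_le (lowSpan_le_upSpan hx) fun f hf => hf.1) fun f hf => ?_
  obtain ⟨g, hg, h⟩ := exists_mem_orthogonal_sub (lowSpan F V m x) f
  rw [Submodule.mem_sup]
  exact ⟨g, hg, f - g, mem_irrepV.2 ⟨Submodule.sub_mem _ hf (lowSpan_le_upSpan hx hg),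
    sum_conj_mul_eq_zero_iff.2 h⟩, by abel⟩

theorem disjoint_irrepV (m x : ℕ) :
    Disjoint (lowSpan F V m x) (irrepV F V m x).toSubmodule := by
  rw [Submodule.disjoint_def]
  intro f h1 h2
  exact eq_zero_of_sum_conj_mul_self (sum_conj_mul_eq_zero_iff.1 (mem_irrepV.1 h2).2 f h1)

theorem iSup_irrepV (m : ℕ) :
    ⨆ x : Fin (m + 1), (irrepV F V m x).toSubmodule = ⊤ := by
  have h : ∀ y ≤ m + 1, lowSpan F V m y ≤ ⨆ x : Fin (m + 1), (irrepV F V m x).toSubmodule := by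
    intro y
    induction y with
    | zero => intro _; rw [lowSpan_zero]; exact bot_le
    | succ y ih =>
      intro hy
      rw [lowSpan_succ_eq_upSpan (by omega), ← sup_irrepV (by omega)]
      exact sup_le (ih (by omega))
        (le_iSup (fun x : Fin (m + 1) => (irrepV F V m x).toSubmodule) ⟨y, by omega⟩)
  rw [eq_top_iff, ← upSpan_self, ← lowSpan_succ_eq_upSpan le_rfl]
  exact h _ le_rfl

theorem isInternal_irrepV {m : ℕ} (hm : 2 * m ≤ finrank F V) :
    DirectSum.IsInternal (fun x : Fin (m + 1) => (irrepV F V m x).toSubmodule) := by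
  refine DirectSum.isInternal_submodule_of_iSupIndep_of_iSup_eq_top ?_ (iSup_irrepV m)
  have hinj : Function.Injective fun x : Fin (m + 1) =>
      (adjEig (Nat.card F) (finrank F V) m x : ℂ) := fun x y h =>
    Fin.ext (adjEig_injOn (one_lt_natCard_field (F := F)) hm (by omega) (by omega)
      (Complex.ofReal_injective h))
  refine ((Module.End.eigenspaces_iSupIndep (adjOp F V m)).comp hinj).mono fun x f hf => ?_
  exact Module.End.mem_eigenspace_iff.2 (adjOp_of_mem_irrepV (by omega) hf)

/-- If the sums of `f` over the hyperplanes of each `(j+1)`-dimensional subspace vanish, where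
`2j < n`, then so do its sums over the `j`-dimensional subspaces containing a given one. -/
theorem sum_supInd_mul_eq_zero {j : ℕ} (hj : 2 * j < finrank F V) (f : Submodule F V → ℂ)
    (hf : ∀ Z : Submodule F V, finrank F Z = j + 1 → ∑ W ∈ covDown ⊥ Z, f W = 0) (a : ℕ) :
    ∀ A : Submodule F V, finrank F A = a → a ≤ j →
      ∑ W ∈ subspacesOfDim F V j, (supInd A W : ℂ) * f W = 0 := by
  induction a using Nat.strong_induction_on with
  | _ a ih =>
    intro A hA ha
    have h1 : ∑ W ∈ subspacesOfDim F V j,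
        ((∑ Z ∈ covUp W ⊤, supInd A Z : ℝ) : ℂ) * f W = 0 := by
      simp only [Complex.ofReal_sum, Finset.sum_mul]
      rw [Finset.sum_comm' (t' := subspacesOfDim F V (j + 1))
        (s' := fun Z => covDown ⊥ Z)]
      · refine Finset.sum_eq_zero fun Z hZ => ?_
        rw [← Finset.mul_sum, hf Z (mem_subspacesOfDim.1 hZ), mul_zero]
      · intro W Z
        simp only [mem_subspacesOfDim, true_and, mem_covUp, mem_covDown, bot_le, le_top]
        constructor
        · rintro ⟨h1, h2, h3⟩; exact ⟨⟨h2, h3.symm⟩, by omega⟩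
        · rintro ⟨⟨h2, h3⟩, h1⟩; exact ⟨by omega, h2, h3.symm⟩
    have h2 : ∀ B ∈ covDown ⊥ A, ∑ W ∈ subspacesOfDim F V j,
        (supInd B W : ℂ) * f W = 0 := fun B hB => by
      have := (mem_covDown.1 hB).2.2
      exact ih (finrank F B) (by omega) B rfl (by omega)
    have hc : (qInt (Nat.card F) (finrank F V - j) - qInt (Nat.card F) a : ℝ) ≠ 0 :=
      (sub_pos.2 (qInt_strictMono one_lt_natCard_field (by omega))).ne'
    have h3 : ((qInt (Nat.card F) (finrank F V - j) - qInt (Nat.card F) a : ℝ) : ℂ) *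
        ∑ W ∈ subspacesOfDim F V j, (supInd A W : ℂ) * f W = 0 := by
      rw [← h1, Finset.mul_sum, ← sub_eq_zero, ← Finset.sum_sub_distrib,
        ← neg_eq_zero, ← Finset.sum_neg_distrib]
      rw [← Finset.sum_eq_zero h2, Finset.sum_comm]
      refine Finset.sum_congr rfl fun W hW => ?_
      rw [sum_covUp_supInd, mem_subspacesOfDim.1 hW, hA, ← Finset.sum_mul]
      push_cast
      ring
    exact (mul_eq_zero.1 h3).resolve_left (by exact_mod_cast hc)

/-- The inclusion matrix of `x`-dimensional in `m`-dimensional subspaces has full rank for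
`x ≤ m ≤ n/2`. By induction on `m`: a combination that vanishes on the `(m+1)`-dimensional
subspaces vanishes on the `m`-dimensional ones by `sum_supInd_mul_eq_zero`. -/
theorem eq_zero_of_sum_mul_supInd_eq_zero {x m : ℕ} (hx : x ≤ m) (h : Gr F V x → ℂ)
    (hm : 2 * m ≤ finrank F V)
    (h0 : ∀ W : Submodule F V, finrank F W = m → ∑ A, h A * (supInd A.1 W : ℂ) = 0) : h = 0 := by
  induction m, hx using Nat.le_induction with
  | base =>
    ext A
    rw [Pi.zero_apply, ← h0 A.1 A.2, Finset.sum_eq_single A]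
    · simp [supInd]
    · intro A' _ hne
      have : ¬ A'.1 ≤ A.1 := fun h => hne (Subtype.ext
        (Submodule.eq_of_le_of_finrank_eq h (A'.2.trans A.2.symm)))
      simp [supInd, this]
    · simp
  | succ m hx ih =>
    refine ih (by omega) fun W hW => ?_
    rw [← sum_supInd_mul_eq_zero (by omega) (fun W => ∑ A, h A * (supInd A.1 W : ℂ)) ?_ m W hW le_rfl,
      Finset.sum_eq_single W]
    · simp [supInd]
    · intro W' hW' hne
      have : ¬ W ≤ W' := fun h => hne (Submodule.eq_of_le_of_finrank_eq h
        (hW.trans (mem_subspacesOfDim.1 hW').symm)).symm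
      simp [supInd, this]
    · intro hW'
      exact absurd (mem_subspacesOfDim.2 hW) hW'
    · intro Z hZ
      rw [Finset.sum_comm]
      have h1 : ∀ A : Gr F V x, ∑ W ∈ covDown ⊥ Z, h A * (supInd A.1 W : ℂ) =
          (qInt (Nat.card F) (m + 1 - x) : ℂ) * (h A * (supInd A.1 Z : ℂ)) := fun A => by
        rw [← Finset.mul_sum, ← Complex.ofReal_sum, sum_covDown_supInd, hZ, A.2]
        push_cast
        ring
      simp only [h1]
      rw [← Finset.mul_sum, h0 Z hZ, mul_zero]

theorem finrank_upSpan {m x : ℕ} (hx : x ≤ m) (hm : 2 * m ≤ finrank F V) :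
    finrank ℂ (upSpan F V m x) = Fintype.card (Gr F V x) := by
  refine finrank_span_eq_card (Fintype.linearIndependent_iff.2 fun h h0 A => ?_)
  refine congrFun (eq_zero_of_sum_mul_supInd_eq_zero hx h hm fun W hW => ?_) A
  refine Eq.trans ?_ ((Finset.sum_apply _ _ _).symm.trans (congrFun h0 ⟨W, hW⟩))
  refine Finset.sum_congr rfl fun A _ => ?_
  exact congrArg (h A * ·) (upFun_eq_supInd m A.1 ⟨W, hW⟩).symm

theorem qBinom_succ_mul {q : ℝ} (hq : 1 < q) (n x : ℕ) :
    qBinom q n (x + 1) * qInt q (x + 1) = qBinom q n x * qInt q (n - x) := by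
  rw [← prod_qInt_div_eq_qBinom hq, Finset.prod_range_succ, prod_qInt_div_eq_qBinom hq, mul_assoc,
    div_mul_cancel₀ _ (qInt_pos hq x.succ_pos).ne']

theorem finrank_irrepV {m x : ℕ} (hx : x ≤ m) (hm : 2 * m ≤ finrank F V) :
    (finrank ℂ (irrepV F V m x).toSubmodule : ℝ) =
      (Nat.card F : ℝ) ^ x * (qInt (Nat.card F) (finrank F V - 2 * x + 1) /
        qInt (Nat.card F) (finrank F V - x + 1)) * qBinom (Nat.card F) (finrank F V) x := by
  have hq : (1 : ℝ) < Nat.card F := one_lt_natCard_field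
  have h1 := Submodule.finrank_sup_add_finrank_inf_eq (lowSpan F V m x) (irrepV F V m x).toSubmodule
  rw [sup_irrepV hx, (disjoint_irrepV m x).eq_bot, finrank_bot, add_zero, finrank_upSpan hx hm] at h1
  have h2 := congrArg (fun n : ℕ => (n : ℝ)) h1
  simp only [Nat.cast_add] at h2
  rw [card_Gr] at h2
  cases x with
  | zero =>
    rw [lowSpan_zero, finrank_bot, Nat.cast_zero, zero_add] at h2
    rw [← h2, Nat.mul_zero, Nat.sub_zero, div_self (qInt_pos hq (Nat.succ_pos _)).ne', pow_zero]
    ring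
  | succ x =>
    rw [lowSpan_succ_eq_upSpan (by omega), finrank_upSpan (by omega) hm, card_Gr] at h2
    have h3 := qBinom_succ_mul hq (finrank F V) x
    have h4 : finrank F V - (x + 1) + 1 = finrank F V - x := by omega
    have h5 : 0 < qInt (Nat.card F) (finrank F V - x) := qInt_pos hq (by omega)
    have h6 : qInt (Nat.card F : ℝ) (finrank F V - x) = qInt (Nat.card F) (x + 1) +
        (Nat.card F : ℝ) ^ (x + 1) * qInt (Nat.card F) (finrank F V - 2 * (x + 1) + 1) := by
      rw [← qInt_add]
      congr 1
      omega
    rw [h4]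
    field_simp
    have h7 : (finrank ℂ (irrepV F V m (x + 1)).toSubmodule : ℝ) =
      qBinom (Nat.card F) (finrank F V) (x + 1) - qBinom (Nat.card F) (finrank F V) x := by
      linarith
    rw [h7, sub_mul, ← h3, h6]
    ring

end Decomposition

end

noncomputable section

/-! ### Transitivity on pairs of subspaces in a given relative position -/

section Transitivity

open Module

variable {F : Type*} [Field F] {V : Type*} [AddCommGroup V] [Module F V]

theorem exists_linearEquiv_glue {p q p' q' : Submodule F V} (h : IsCompl p q) (h' : IsCompl p' q')
    (e₁ : p ≃ₗ[F] p') (e₂ : q ≃ₗ[F] q') :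
    ∃ g : V ≃ₗ[F] V, (∀ x : p, g x = e₁ x) ∧ ∀ x : q, g x = e₂ x := by
  refine ⟨(p.prodEquivOfIsCompl q h).symm ≪≫ₗ LinearEquiv.prodCongr e₁ e₂ ≪≫ₗ
    p'.prodEquivOfIsCompl q' h', fun x => ?_, fun x => ?_⟩ <;> simp

variable [FiniteDimensional F V]

theorem exists_linearEquiv_mapping_flag {s W s' W' : Submodule F V} (hs : s ≤ W) (hs' : s' ≤ W')
    (h : finrank F s = finrank F s') (hW : finrank F W = finrank F W') :
    ∃ e : W ≃ₗ[F] W', ∀ x : W, (x : V) ∈ s → (e x : V) ∈ s' := by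
  let e₀ : W ≃ₗ[F] W' := LinearEquiv.ofFinrankEq W W' hW
  let t := (s.comap W.subtype).map e₀.toLinearMap
  let t' := s'.comap W'.subtype
  have ht : finrank F t = finrank F t' := by
    rw [LinearEquiv.finrank_map_eq e₀, (Submodule.comapSubtypeEquivOfLe hs).finrank_eq,
      (Submodule.comapSubtypeEquivOfLe hs').finrank_eq, h]
  obtain ⟨g, hg⟩ := Submodule.exists_linearEquiv_restrict_eq (LinearEquiv.ofFinrankEq t t' ht)
  refine ⟨e₀.trans g, fun x hx => ?_⟩
  have hx' : e₀ x ∈ t := ⟨x, hx, rfl⟩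
  have h1 := hg ⟨e₀ x, hx'⟩
  rw [LinearEquiv.trans_apply, ← h1]
  exact (LinearEquiv.ofFinrankEq t t' ht ⟨e₀ x, hx'⟩).2

/-- A complement of `W₁` together with a part of it that completes `W₁ ∩ W₂` to `W₂`. -/
theorem exists_isCompl_adapted (W₁ W₂ : Submodule F V) :
    ∃ P Q : Submodule F V, P ≤ Q ∧ IsCompl W₁ Q ∧ W₁ ⊓ W₂ ⊔ P = W₂ ∧
      finrank F ↥(W₁ ⊓ W₂) + finrank F P = finrank F W₂ := by
  obtain ⟨R, hR⟩ := exists_isCompl (W₁ ⊓ W₂)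
  have h1 : W₁ ⊓ W₂ ⊔ R ⊓ W₂ = W₂ := by
    rw [← sup_inf_assoc_of_le R inf_le_right, hR.sup_eq_top, top_inf_eq]
  have h2 : Disjoint W₁ (R ⊓ W₂) := by
    rw [disjoint_iff, inf_comm R, ← inf_assoc, hR.inf_eq_bot]
  obtain ⟨Q, hQ, hc⟩ := h2.symm.exists_isCompl
  refine ⟨R ⊓ W₂, Q, hQ, hc.symm, h1, ?_⟩
  have h3 := Submodule.finrank_sup_add_finrank_inf_eq (W₁ ⊓ W₂) (R ⊓ W₂)
  have h4 : W₁ ⊓ W₂ ⊓ (R ⊓ W₂) = ⊥ :=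
    le_bot_iff.1 ((inf_le_inf_left _ inf_le_left).trans hR.inf_eq_bot.le)
  rw [h1, h4, finrank_bot, add_zero] at h3
  exact h3.symm

/-- The general linear group is transitive on pairs of `m`-dimensional subspaces whose
intersection has a given dimension. -/
theorem exists_smul_eq_smul_eq {m : ℕ} {W₁ W₂ W₁' W₂' : Gr F V m}
    (h : finrank F ↥(W₁.1 ⊓ W₂.1) = finrank F ↥(W₁'.1 ⊓ W₂'.1)) :
    ∃ g : V ≃ₗ[F] V, g • W₁ = W₁' ∧ g • W₂ = W₂' := by
  obtain ⟨P, Q, hPQ, hc, hP, hd⟩ := exists_isCompl_adapted W₁.1 W₂.1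
  obtain ⟨P', Q', hPQ', hc', hP', hd'⟩ := exists_isCompl_adapted W₁'.1 W₂'.1
  have hW₁ := W₁.2
  have hW₂ := W₂.2
  have hW₁' := W₁'.2
  have hW₂' := W₂'.2
  have hQ := Submodule.finrank_add_eq_of_isCompl hc
  have hQ' := Submodule.finrank_add_eq_of_isCompl hc'
  obtain ⟨e₁, he₁⟩ := exists_linearEquiv_mapping_flag (inf_le_left : W₁.1 ⊓ W₂.1 ≤ W₁.1)
    (inf_le_left : W₁'.1 ⊓ W₂'.1 ≤ W₁'.1) h (by omega)
  obtain ⟨e₂, he₂⟩ := exists_linearEquiv_mapping_flag hPQ hPQ' (by omega) (by omega)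
  obtain ⟨g, hg₁, hg₂⟩ := exists_linearEquiv_glue hc hc' e₁ e₂
  refine ⟨g, Subtype.ext ?_, Subtype.ext ?_⟩
  · refine Submodule.eq_of_le_of_finrank_eq ?_ (((g • W₁).2).trans W₁'.2.symm)
    rintro _ ⟨x, hx, rfl⟩
    have := hg₁ ⟨x, hx⟩
    rw [LinearEquiv.coe_coe, this]
    exact (e₁ ⟨x, hx⟩).2
  · refine Submodule.eq_of_le_of_finrank_eq ?_ (((g • W₂).2).trans W₂'.2.symm)
    rw [Gr.smul_val, ← hP, Submodule.map_sup]
    refine sup_le ?_ ?_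
    · rintro _ ⟨x, hx, rfl⟩
      have := hg₁ ⟨x, hx.1⟩
      rw [LinearEquiv.coe_coe, this]
      exact (he₁ ⟨x, hx.1⟩ hx).2
    · rintro _ ⟨x, hx, rfl⟩
      have := hg₂ ⟨x, hPQ hx⟩
      rw [LinearEquiv.coe_coe, this, ← hP']
      exact Submodule.mem_sup_right (he₂ ⟨x, hPQ hx⟩ hx)

theorem exists_smul_eq {m : ℕ} (U U' : Gr F V m) : ∃ g : V ≃ₗ[F] V, g • U = U' := by
  obtain ⟨g, hg, -⟩ := exists_smul_eq_smul_eq (W₁ := U) (W₂ := U) (W₁' := U') (W₂' := U')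
    (by rw [inf_idem, inf_idem, U.2, U'.2])
  exact ⟨g, hg⟩

end Transitivity

end

noncomputable section

/-! ### `q`-Hahn polynomials as spherical eigenfunctions -/

section HahnSeries

theorem qPoch_succ (a q : ℝ) (r : ℕ) : qPoch a q (r + 1) = qPoch a q r * (1 - a * q ^ r) :=
  Finset.prod_range_succ _ _

theorem qPoch_inv_pow_eq_zero {q : ℝ} (hq : q ≠ 0) {x r : ℕ} (h : x < r) :
    qPoch (q ^ (-(x : ℤ))) q r = 0 := by
  refine Finset.prod_eq_zero (Finset.mem_range.2 h) ?_
  rw [zpow_neg, zpow_natCast, inv_mul_cancel₀ (pow_ne_zero _ hq), sub_self]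

/-- The `r`-th coefficient of the `q`-Hahn polynomial of degree `x` with respect to the functions
`i ↦ (q^{-i};q)_r`. -/
def qHahnCoeff (q : ℝ) (n m x r : ℕ) : ℝ :=
  qPoch (q ^ (-(x : ℤ))) q r * qPoch (q ^ ((x : ℤ) - n - 1)) q r /
    (qPoch q q r * (qPoch (q ^ (-(m : ℤ))) q r * qPoch (q ^ ((m : ℤ) - n)) q r)) * q ^ r

theorem qHahnValue_eq_sum {q : ℝ} (hq : q ≠ 0) (n m x i : ℕ) :
    qHahnValue q n m x i =
      ∑ r ∈ Finset.range (x + 1), qHahnCoeff q n m x r * qPoch (q ^ (-(i : ℤ))) q r := by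
  unfold qHahnValue qHyp
  rw [tsum_eq_sum (s := Finset.range (x + 1))]
  · refine Finset.sum_congr rfl fun r _ => ?_
    simp only [List.map_cons, List.map_nil, List.prod_cons, List.prod_nil, List.length_cons,
      List.length_nil, qHahnCoeff]
    norm_num
    ring
  · intro r hr
    rw [Finset.mem_range, not_lt] at hr
    simp only [List.map_cons, List.map_nil, List.prod_cons, qPoch_inv_pow_eq_zero hq hr]
    simp

theorem qRacahPmf_eq_sum {q : ℝ} (hq : q ≠ 0) (n m k l x : ℕ) :
    qRacahPmf q n m k l x = qBinom q (n - k) (m - l) * qPrefactor q n m x *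
      ∑ r ∈ Finset.range (x + 1), qHahnCoeff q n m x r *
        (qPoch (q ^ (-((m - l : ℕ) : ℤ))) q r * qPoch (q ^ (-((n + l - m - k : ℕ) : ℤ))) q r /
          qPoch (q ^ (-((m - l : ℕ) : ℤ) - ((n + l - m - k : ℕ) : ℤ))) q r) := by
  unfold qRacahPmf qHyp
  rw [tsum_eq_sum (s := Finset.range (x + 1))]
  · refine congrArg _ (Finset.sum_congr rfl fun r _ => ?_)
    simp only [List.map_cons, List.map_nil, List.prod_cons, List.prod_nil, List.length_cons,
      List.length_nil, qHahnCoeff, mul_one]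
    norm_num
    simp only [div_eq_mul_inv, mul_inv]
    ring
  · intro r hr
    rw [Finset.mem_range, not_lt] at hr
    simp only [List.map_cons, List.map_nil, List.prod_cons, qPoch_inv_pow_eq_zero hq hr]
    simp

theorem qHahnValue_zero {q : ℝ} (hq : q ≠ 0) (n m x : ℕ) : qHahnValue q n m x 0 = 1 := by
  rw [qHahnValue_eq_sum hq, Finset.sum_eq_single 0]
  · simp [qHahnCoeff, qPoch]
  · intro r _ hr
    rw [qPoch_inv_pow_eq_zero hq (Nat.pos_of_ne_zero hr), mul_zero]
  · simp

/-- The coefficient of the lower order term when `adjOp` is applied to a sum of indicator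
functions `disjInd`. -/
def adjLower (q : ℝ) (n m r : ℕ) : ℝ :=
  (qInt q (n + 1 - m) - qInt q (r + 1)) * q ^ (m - (r + 1)) * qInt q (m - r)

theorem adjLower_pos {q : ℝ} (hq : 1 < q) {n m r : ℕ} (hm : 2 * m ≤ n) (hr : r < m) :
    0 < adjLower q n m r :=
  mul_pos (mul_pos (sub_pos.2 (qInt_strictMono hq (by omega))) (pow_pos (by linarith) _))
    (qInt_pos hq (by omega))

/-- The coefficients of the eigenfunction of `adjOp` with respect to the sums of the functions
`disjInd`. -/
def sphCoeff (q : ℝ) (n m x r : ℕ) : ℝ :=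
  ∏ j ∈ Finset.range r, (adjEig q n m x - adjEig q n m j) / adjLower q n m j

theorem qInt_sub_eq_div {q : ℝ} (hq : 1 < q) {a b : ℕ} (h : b ≤ a) :
    qInt q (a - b) = (q ^ a / q ^ b - 1) / (q - 1) := by
  rw [qInt_eq_div hq, pow_sub₀ _ (by linarith) h, div_eq_mul_inv (q ^ a)]

/-- The solution of the two-term recursion for eigenfunctions is the `q`-Hahn polynomial, term by
term. -/
theorem sphCoeff_mul_prod {q : ℝ} (hq : 1 < q) {n m x i r : ℕ} (hm : 2 * m ≤ n) (hx : x ≤ m)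
    (hi : i ≤ m) (hr : r ≤ x) :
    sphCoeff q n m x r * ∏ j ∈ Finset.range r, (qInt q (m - j) - qInt q (m - i)) / qInt q (j + 1) =
      qHahnCoeff q n m x r * qPoch (q ^ (-(i : ℤ))) q r := by
  have hq0 : q ≠ 0 := by linarith
  unfold sphCoeff qHahnCoeff qPoch
  rw [← Finset.prod_mul_distrib, ← Finset.prod_mul_distrib, ← Finset.prod_mul_distrib,
    ← Finset.prod_mul_distrib, ← Finset.prod_div_distrib, ← Finset.card_range r,
    ← Finset.prod_const, Finset.card_range, ← Finset.prod_mul_distrib, ← Finset.prod_mul_distrib]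
  refine Finset.prod_congr rfl fun j hj => ?_
  have hj' : j < x := (Finset.mem_range.1 hj).trans_le hr
  unfold adjEig adjLower
  rw [qInt_sub_eq_div hq (show m ≤ n + 1 by omega), qInt_sub_eq_div hq (show x ≤ m by omega),
    qInt_sub_eq_div hq (show j ≤ m by omega), qInt_sub_eq_div hq hi, qInt_eq_div hq x,
    qInt_eq_div hq j, qInt_eq_div hq (j + 1), pow_sub₀ q hq0 (show j + 1 ≤ m by omega),
    sub_sub (x : ℤ), zpow_sub₀ hq0, zpow_sub₀ hq0, zpow_neg, zpow_neg, zpow_neg,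
    show ((n : ℤ) + 1) = ((n + 1 : ℕ) : ℤ) by push_cast; rfl]
  simp only [zpow_natCast]
  have h1 : q - 1 ≠ 0 := by linarith
  have hmono := pow_right_strictMono₀ hq
  have h2 : q ^ m - q ^ j ≠ 0 := (sub_pos.2 (hmono (by omega))).ne'
  have h3 : q ^ n - q ^ m * q ^ j ≠ 0 := by
    rw [← pow_add]; exact (sub_pos.2 (hmono (by omega))).ne'
  have h4 : q * q ^ j - 1 ≠ 0 := by
    rw [← pow_succ', ← pow_zero q]; exact (sub_pos.2 (hmono (by omega))).ne'
  have p1 : q ^ m ≠ 0 := pow_ne_zero _ hq0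
  have p2 : q ^ j ≠ 0 := pow_ne_zero _ hq0
  have p3 : q ^ n ≠ 0 := pow_ne_zero _ hq0
  have p4 : q ^ x ≠ 0 := pow_ne_zero _ hq0
  have p5 : q ^ i ≠ 0 := pow_ne_zero _ hq0
  rw [pow_succ' q n, pow_succ' q j]
  generalize q ^ m = M at *
  generalize q ^ j = Y at *
  generalize q ^ n = N at *
  generalize q ^ x = X at *
  generalize q ^ i = I at *
  have d1 : (q * N / M - 1) / (q - 1) - (q * Y - 1) / (q - 1) = q * (N - M * Y) / (M * (q - 1)) := by
    field_simp; ring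
  have d2 : (M / Y - 1) / (q - 1) = (M - Y) / (Y * (q - 1)) := by field_simp
  have d3 : 1 - q * Y = -(q * Y - 1) := by ring
  have d4 : 1 - M⁻¹ * Y = (M - Y) / M := by field_simp
  have d5 : 1 - M / N * Y = (N - M * Y) / N := by field_simp
  rw [d1, d2, d3, d4, d5]
  field_simp
  ring

end HahnSeries

section Spherical

open Module

variable {F : Type*} [Field F] {V : Type*} [AddCommGroup V] [Module F V]

/-- The value at `W` of the spherical function of degree `x` centred at `U`. -/
def sphFun {m : ℕ} (x : ℕ) (U W : Gr F V m) : ℝ :=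
  qHahnValue (Nat.card F) (finrank F V) m x (m - finrank F ↥(U.1 ⊓ W.1))

theorem finrank_inf_le [FiniteDimensional F V] {m : ℕ} (U W : Gr F V m) : finrank F ↥(U.1 ⊓ W.1) ≤ m :=
  (Submodule.finrank_mono inf_le_left).trans U.2.le

theorem sphFun_comm {m : ℕ} (x : ℕ) (U W : Gr F V m) : sphFun x U W = sphFun x W U := by
  rw [sphFun, sphFun, inf_comm]

theorem sphFun_self [Finite F] {m : ℕ} (x : ℕ) (U : Gr F V m) : sphFun x U U = 1 := by
  have hq : (1 : ℝ) < Nat.card F := one_lt_natCard_field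
  rw [sphFun, inf_idem, U.2, Nat.sub_self, qHahnValue_zero (by linarith)]

variable [Finite F] [FiniteDimensional F V]

/-- The number of `r`-dimensional subspaces of `U` that meet `W` trivially. -/
def disjSum (U : Submodule F V) (r : ℕ) (W : Submodule F V) : ℝ :=
  ∑ A ∈ relDisj ⊥ ⊥ U r, disjInd A W

theorem mem_relDisj_bot {A U : Submodule F V} {r : ℕ} :
    A ∈ relDisj ⊥ ⊥ U r ↔ A ≤ U ∧ finrank F A = r := by
  simp [mem_relDisj]

theorem disjSum_eq_prod (U W : Submodule F V) (r : ℕ) :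
    disjSum U r W = ∏ j ∈ Finset.range r, (qInt (Nat.card F) (finrank F U - j) -
      qInt (Nat.card F) (finrank F ↥(U ⊓ W))) / qInt (Nat.card F) (j + 1) := by
  classical
  have h := card_relDisj (C := ⊥) (U := U ⊓ W) (Z := U) bot_le inf_le_left r
  simp only [finrank_bot, Nat.sub_zero] at h
  rw [← h, disjSum]
  unfold disjInd
  rw [Finset.sum_boole]
  congr 2
  ext A
  rw [Finset.mem_filter, mem_relDisj_bot, mem_relDisj, finrank_bot, zero_add]
  constructor
  · rintro ⟨⟨h1, h2⟩, h3⟩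
    exact ⟨bot_le, h1, h2, by rw [← inf_assoc, inf_eq_left.2 h1, h3]⟩
  · rintro ⟨-, h1, h2, h3⟩
    exact ⟨⟨h1, h2⟩, by rw [← h3, ← inf_assoc, inf_eq_left.2 h1]⟩

theorem downUp_sum {ι : Type*} (s : Finset ι) (f : ι → Submodule F V → ℝ) (W : Submodule F V) :
    downUp (fun W => ∑ i ∈ s, f i W) W = ∑ i ∈ s, downUp (f i) W := by
  unfold downUp
  rw [Finset.sum_comm]
  exact Finset.sum_congr rfl fun H _ => Finset.sum_comm

theorem downUp_const_mul (c : ℝ) (f : Submodule F V → ℝ) (W : Submodule F V) :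
    downUp (fun W => c * f W) W = c * downUp f W := by
  simp only [downUp, Finset.mul_sum]

theorem downUp_disjSum_aux {m r : ℕ} {U W : Submodule F V} (hW : finrank F W = m) (hr : r ≤ m) :
    downUp (disjSum U r) W = adjEig (Nat.card F) (finrank F V) m r * disjSum U r W +
      (qInt (Nat.card F) (finrank F V + 1 - m) - qInt (Nat.card F) r) *
        (Nat.card F : ℝ) ^ (m - r) *
        ∑ A ∈ relDisj ⊥ ⊥ U r, ∑ B ∈ covDown ⊥ A, disjInd B W := by
  have h : downUp (disjSum U r) W = ∑ A ∈ relDisj ⊥ ⊥ U r, downUp (disjInd A) W :=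
    downUp_sum _ _ _
  rw [h, disjSum, Finset.mul_sum, Finset.mul_sum, ← Finset.sum_add_distrib]
  refine Finset.sum_congr rfl fun A hA => ?_
  have hA' := (mem_relDisj_bot.1 hA).2
  rw [downUp_disjInd (by omega), hA', hW, adjEig]
  ring

theorem downUp_disjSum_zero {m : ℕ} {U W : Submodule F V} (hW : finrank F W = m) :
    downUp (disjSum U 0) W = adjEig (Nat.card F) (finrank F V) m 0 * disjSum U 0 W := by
  rw [downUp_disjSum_aux hW (Nat.zero_le m), Finset.sum_eq_zero, mul_zero, add_zero]
  intro A hA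
  refine Finset.sum_eq_zero fun B hB => ?_
  have := (mem_covDown.1 hB).2.2
  have := (mem_relDisj_bot.1 hA).2
  omega

theorem downUp_disjSum_succ {m r : ℕ} {U W : Submodule F V} (hU : finrank F U = m)
    (hW : finrank F W = m) (hr : r + 1 ≤ m) :
    downUp (disjSum U (r + 1)) W =
      adjEig (Nat.card F) (finrank F V) m (r + 1) * disjSum U (r + 1) W +
      adjLower (Nat.card F) (finrank F V) m r * disjSum U r W := by
  rw [downUp_disjSum_aux hW hr, adjLower, mul_assoc _ (qInt _ (m - r)), disjSum, disjSum,
    Finset.mul_sum (relDisj ⊥ ⊥ U r)]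
  congr 2
  rw [Finset.sum_comm' (t' := relDisj ⊥ ⊥ U r) (s' := fun B => covUp B U)]
  · refine Finset.sum_congr rfl fun B hB => ?_
    obtain ⟨h1, h2⟩ := mem_relDisj_bot.1 hB
    rw [Finset.sum_const, nsmul_eq_mul, card_covUp h1, hU, h2]
  · intro A B
    rw [mem_relDisj_bot, mem_relDisj_bot, mem_covUp, mem_covDown]
    constructor
    · rintro ⟨⟨h1, h2⟩, -, h3, h4⟩
      exact ⟨⟨h3, h1, by omega⟩, h3.trans h1, by omega⟩
    · rintro ⟨⟨h1, h2, h3⟩, h4, h5⟩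
      exact ⟨⟨h2, by omega⟩, bot_le, h1, by omega⟩

/-- The combination of the functions `disjSum U r`, `r ≤ x`, that is an eigenfunction of
`downUp` on the `m`-dimensional subspaces. -/
def sphSum (m x : ℕ) (U W : Submodule F V) : ℝ :=
  ∑ r ∈ Finset.range (x + 1), sphCoeff (Nat.card F) (finrank F V) m x r * disjSum U r W

theorem downUp_sphSum {m x : ℕ} (hm : 2 * m ≤ finrank F V) (hx : x ≤ m) {U W : Submodule F V}
    (hU : finrank F U = m) (hW : finrank F W = m) :
    downUp (sphSum m x U) W = adjEig (Nat.card F) (finrank F V) m x * sphSum m x U W := by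
  have hq : (1 : ℝ) < Nat.card F := one_lt_natCard_field
  have h : downUp (sphSum m x U) W = ∑ r ∈ Finset.range (x + 1),
      sphCoeff (Nat.card F) (finrank F V) m x r * downUp (disjSum U r) W := by
    refine (downUp_sum _ _ _).trans (Finset.sum_congr rfl fun r _ => ?_)
    exact downUp_const_mul _ _ _
  -- the lower order term of each summand combines with the leading term of its predecessor
  have hstep : ∀ y ≤ x, ∑ r ∈ Finset.range (y + 1),
      sphCoeff (Nat.card F) (finrank F V) m x r * downUp (disjSum U r) W =
      adjEig (Nat.card F) (finrank F V) m x * (∑ r ∈ Finset.range (y + 1),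
        sphCoeff (Nat.card F) (finrank F V) m x r * disjSum U r W) -
      (adjEig (Nat.card F) (finrank F V) m x - adjEig (Nat.card F) (finrank F V) m y) *
        (sphCoeff (Nat.card F) (finrank F V) m x y * disjSum U y W) := by
    intro y
    induction y with
    | zero =>
      intro _
      rw [zero_add, Finset.sum_range_one, Finset.sum_range_one, downUp_disjSum_zero hW]
      ring
    | succ y ih =>
      intro hy
      rw [Finset.sum_range_succ, ih (by omega), Finset.sum_range_succ _ (y + 1),
        downUp_disjSum_succ hU hW (by omega)]
      have hc : sphCoeff (Nat.card F) (finrank F V) m x (y + 1) *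
          adjLower (Nat.card F) (finrank F V) m y =
          sphCoeff (Nat.card F) (finrank F V) m x y *
          (adjEig (Nat.card F) (finrank F V) m x - adjEig (Nat.card F) (finrank F V) m y) := by
        rw [sphCoeff, Finset.prod_range_succ, ← sphCoeff, mul_assoc,
          div_mul_cancel₀ _ (adjLower_pos hq hm (by omega)).ne']
      linear_combination (disjSum U y W) * hc
  rw [h, hstep x le_rfl, sub_self, zero_mul, sub_zero, sphSum]

theorem sphFun_eq_sphSum {m x : ℕ} (hm : 2 * m ≤ finrank F V) (hx : x ≤ m) (U W : Gr F V m) :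
    sphFun x U W = sphSum m x U.1 W.1 := by
  have hq : (1 : ℝ) < Nat.card F := one_lt_natCard_field
  rw [sphFun, qHahnValue_eq_sum (by linarith), sphSum]
  refine Finset.sum_congr rfl fun r hr => ?_
  rw [Finset.mem_range] at hr
  rw [← sphCoeff_mul_prod hq hm hx (Nat.sub_le _ _) (by omega), disjSum_eq_prod, U.2,
    Nat.sub_sub_self (finrank_inf_le U W)]

theorem adjOp_sphFun {m x : ℕ} (hm : 2 * m ≤ finrank F V) (hx : x ≤ m) (U : Gr F V m) :
    adjOp F V m (fun W => (sphFun x U W : ℂ)) =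
      (adjEig (Nat.card F) (finrank F V) m x : ℂ) • fun W => (sphFun x U W : ℂ) := by
  have h : (fun W => (sphFun x U W : ℂ)) = fun W : Gr F V m => (sphSum m x U.1 W.1 : ℂ) :=
    funext fun W => by rw [sphFun_eq_sphSum hm hx]
  ext W
  rw [h, adjOp_ofReal, downUp_sphSum hm hx U.2 W.2]
  simp

end Spherical

end

noncomputable section

/-! ### The projectors onto the constituents, irreducibility, and zonal spherical functions -/

section Projector

open Module

theorem trace_eq_sum_single {ι : Type*} [Fintype ι] [DecidableEq ι]
    (f : (ι → ℂ) →ₗ[ℂ] (ι → ℂ)) : LinearMap.trace ℂ _ f = ∑ i, f (Pi.single i 1) i := by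
  rw [← Matrix.toLin'_toMatrix' f, Matrix.trace_toLin'_eq, Matrix.trace]
  simp [LinearMap.toMatrix'_apply]

variable {F : Type*} [Field F] {V : Type*} [AddCommGroup V] [Module F V]

theorem sphFun_smul {m : ℕ} (x : ℕ) (g : V ≃ₗ[F] V) (U W : Gr F V m) :
    sphFun x (g • U) (g • W) = sphFun x U W := by
  rw [sphFun, sphFun, Gr.smul_val, Gr.smul_val, ← Submodule.map_inf _ g.injective,
    LinearEquiv.finrank_map_eq]

theorem permRep_sphFun {m : ℕ} (x : ℕ) (g : V ≃ₗ[F] V) (U : Gr F V m) :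
    permRep F V m g (fun W => (sphFun x U W : ℂ)) = fun W => (sphFun x (g • U) W : ℂ) := by
  ext W
  rw [permRep_apply, ← sphFun_smul x g, smul_inv_smul]

variable [Finite F] [FiniteDimensional F V]

/-- The `V_x` lie in the eigenspaces and already span everything, while eigenspaces are
independent. -/
theorem irrepV_eq_eigenspace {m x : ℕ} (hm : 2 * m ≤ finrank F V) (hx : x ≤ m) :
    (irrepV F V m x).toSubmodule = Module.End.eigenspace (adjOp F V m)
      (adjEig (Nat.card F) (finrank F V) m x : ℂ) := by
  have hinj : Function.Injective fun x : Fin (m + 1) =>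
      (adjEig (Nat.card F) (finrank F V) m x : ℂ) := fun x y h =>
    Fin.ext (adjEig_injOn (one_lt_natCard_field (F := F)) hm (by omega) (by omega)
      (Complex.ofReal_injective h))
  have h := (((Module.End.eigenspaces_iSupIndep (adjOp F V m)).comp hinj).le_iff_eq_of_iSup_eq_top
    (iSup_irrepV (F := F) (V := V) m)).1 fun x f hf =>
      Module.End.mem_eigenspace_iff.2 (adjOp_of_mem_irrepV (by omega) hf)
  exact congrFun h ⟨x, by omega⟩

theorem mem_irrepV_iff {m x : ℕ} (hm : 2 * m ≤ finrank F V) (hx : x ≤ m) {f : Gr F V m → ℂ} :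
    f ∈ (irrepV F V m x).toSubmodule ↔
      adjOp F V m f = (adjEig (Nat.card F) (finrank F V) m x : ℂ) • f := by
  rw [irrepV_eq_eigenspace hm hx, Module.End.mem_eigenspace_iff]

theorem sphFun_mem_irrepV {m x : ℕ} (hm : 2 * m ≤ finrank F V) (hx : x ≤ m) (U : Gr F V m) :
    (fun W => (sphFun x U W : ℂ)) ∈ (irrepV F V m x).toSubmodule :=
  (mem_irrepV_iff hm hx).2 (adjOp_sphFun hm hx U)

theorem sum_conj_mul_eq_zero_of_mem_irrepV {m x y : ℕ} (hm : 2 * m ≤ finrank F V) (hx : x ≤ m)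
    (hy : y ≤ m) (hxy : x ≠ y) {f g : Gr F V m → ℂ} (hf : f ∈ (irrepV F V m x).toSubmodule)
    (hg : g ∈ (irrepV F V m y).toSubmodule) : ∑ W, conj (f W) * g W = 0 := by
  have h := sum_conj_adjOp_mul f g
  rw [adjOp_of_mem_irrepV hx hf, adjOp_of_mem_irrepV hy hg] at h
  simp only [Pi.smul_apply, smul_eq_mul, map_mul, Complex.conj_ofReal, mul_assoc,
    mul_left_comm _ (Complex.ofReal _)] at h
  rw [← Finset.mul_sum, ← Finset.mul_sum] at h
  by_contra h0
  exact hxy (adjEig_injOn (one_lt_natCard_field (F := F)) hm hx hy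
    (Complex.ofReal_injective (mul_right_cancel₀ h0 h)))

variable (F V) in
/-- The operator on functions on `Gr(m,n)` with kernel `sphFun x`. -/
def sphOp (m x : ℕ) : (Gr F V m → ℂ) →ₗ[ℂ] (Gr F V m → ℂ) where
  toFun f U := ∑ W, (sphFun x U W : ℂ) * f W
  map_add' f g := by ext W; simp [mul_add, Finset.sum_add_distrib]
  map_smul' c f := by ext W; simp [Finset.mul_sum, mul_left_comm]

theorem sphOp_apply {m x : ℕ} (f : Gr F V m → ℂ) (U : Gr F V m) :
    sphOp F V m x f U = ∑ W, (sphFun x U W : ℂ) * f W := rfl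

theorem sphOp_eq_sum {m x : ℕ} (f : Gr F V m → ℂ) :
    sphOp F V m x f = ∑ W, f W • fun U => (sphFun x W U : ℂ) := by
  ext U
  rw [sphOp_apply, Finset.sum_apply]
  refine Finset.sum_congr rfl fun W _ => ?_
  rw [Pi.smul_apply, smul_eq_mul, mul_comm, sphFun_comm]

theorem sphOp_mem_irrepV {m x : ℕ} (hm : 2 * m ≤ finrank F V) (hx : x ≤ m) (f : Gr F V m → ℂ) :
    sphOp F V m x f ∈ (irrepV F V m x).toSubmodule := by
  rw [sphOp_eq_sum]
  exact Submodule.sum_mem _ fun W _ => Submodule.smul_mem _ _ (sphFun_mem_irrepV hm hx W)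

theorem sphOp_eq_zero {m x y : ℕ} (hm : 2 * m ≤ finrank F V) (hx : x ≤ m) (hy : y ≤ m)
    (hxy : x ≠ y) {f : Gr F V m → ℂ} (hf : f ∈ (irrepV F V m y).toSubmodule) :
    sphOp F V m x f = 0 := by
  ext U
  have := sum_conj_mul_eq_zero_of_mem_irrepV hm hx hy hxy (sphFun_mem_irrepV hm hx U) hf
  simp only [Complex.conj_ofReal] at this
  rw [sphOp_apply, this, Pi.zero_apply]

theorem nonempty_Gr {m : ℕ} (hm : m ≤ finrank F V) : Nonempty (Gr F V m) := by
  rw [← Fintype.card_pos_iff, ← Nat.cast_pos (α := ℝ), card_Gr]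
  exact qBinom_pos one_lt_natCard_field hm

/-- Every function of the distance to a point is a combination of the spherical functions
centred there: these are `m + 1` eigenvectors for distinct eigenvalues, and there are at most
`m + 1` distances. -/
theorem exists_eq_sum_sphFun {m : ℕ} (hm : 2 * m ≤ finrank F V) (ψ : ℕ → ℂ) :
    ∃ c : Fin (m + 1) → ℂ, ∀ U W : Gr F V m,
      ψ (m - finrank F ↥(U.1 ⊓ W.1)) = ∑ y, c y * (sphFun y U W : ℂ) := by
  obtain ⟨U₀⟩ := nonempty_Gr (F := F) (V := V) (m := m) (by omega)
  let v : Fin (m + 1) → Fin (m + 1) → ℂ := fun y i =>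
    (qHahnValue (Nat.card F) (finrank F V) m y i : ℂ)
  let d : Gr F V m → Fin (m + 1) := fun W => ⟨m - finrank F ↥(U₀.1 ⊓ W.1), by omega⟩
  have hli : LinearIndependent ℂ v := by
    refine LinearIndependent.of_comp (LinearMap.funLeft ℂ ℂ d) ?_
    refine Module.End.eigenvectors_linearIndependent' (adjOp F V m)
      (fun y : Fin (m + 1) => (adjEig (Nat.card F) (finrank F V) m y : ℂ)) (fun x y h => ?_) _
      fun y => ⟨?_, fun h => ?_⟩
    · exact Fin.ext (adjEig_injOn (one_lt_natCard_field (F := F)) hm (by omega) (by omega)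
        (Complex.ofReal_injective h))
    · exact Module.End.mem_eigenspace_iff.2 (adjOp_sphFun hm (by omega) U₀)
    · have h1 : (sphFun y U₀ U₀ : ℂ) = 0 := congrFun h U₀
      rw [sphFun_self] at h1
      exact one_ne_zero (Complex.ofReal_eq_zero.1 h1)
  have htop : (fun i : Fin (m + 1) => ψ i) ∈ Submodule.span ℂ (Set.range v) := by
    rw [hli.span_eq_top_of_card_eq_finrank (by simp)]
    exact Submodule.mem_top
  obtain ⟨c, hc⟩ := (Submodule.mem_span_range_iff_exists_fun ℂ).1 htop
  refine ⟨c, fun U W => ?_⟩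
  have h := congrFun hc ⟨m - finrank F ↥(U.1 ⊓ W.1), by omega⟩
  rw [Finset.sum_apply] at h
  exact h.symm

/-- Expanding point masses in spherical functions shows that some multiple of `sphOp` is the
projector onto `V_x`. -/
theorem exists_smul_sphOp_eq {m : ℕ} (hm : 2 * m ≤ finrank F V) :
    ∃ c : Fin (m + 1) → ℂ, ∀ x : Fin (m + 1), ∀ f ∈ (irrepV F V m x).toSubmodule,
      c x • sphOp F V m x f = f := by
  classical
  obtain ⟨c, hc⟩ := exists_eq_sum_sphFun (F := F) (V := V) hm (fun i => if i = 0 then 1 else 0)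
  refine ⟨c, fun x f hf => ?_⟩
  -- the point mass at `U`, written in terms of the spherical functions centred at `U`
  have hδ : ∀ U W : Gr F V m, (if U = W then (1 : ℂ) else 0) = ∑ y, c y * (sphFun y U W : ℂ) := by
    intro U W
    rw [← hc U W]
    refine if_congr ?_ rfl rfl
    constructor
    · rintro rfl
      rw [inf_idem, U.2, Nat.sub_self]
    · intro h
      have h1 : finrank F ↥(U.1 ⊓ W.1) = m := by
        have := finrank_inf_le U W
        omega
      have h2 := Submodule.eq_of_le_of_finrank_eq (inf_le_left : U.1 ⊓ W.1 ≤ U.1) (h1.trans U.2.symm)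
      have h3 := Submodule.eq_of_le_of_finrank_eq (inf_le_right : U.1 ⊓ W.1 ≤ W.1)
        (h1.trans W.2.symm)
      exact Subtype.ext (h2.symm.trans h3)
  ext U
  have h1 : f U = ∑ y : Fin (m + 1), c y * sphOp F V m y f U := by
    calc f U = ∑ W, (if U = W then (1 : ℂ) else 0) * f W := by simp
      _ = ∑ W, ∑ y : Fin (m + 1), c y * ((sphFun y U W : ℂ) * f W) := by
        refine Finset.sum_congr rfl fun W _ => ?_
        rw [hδ, Finset.sum_mul]
        exact Finset.sum_congr rfl fun y _ => mul_assoc _ _ _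
      _ = _ := by
        rw [Finset.sum_comm]
        refine Finset.sum_congr rfl fun y _ => ?_
        rw [sphOp_apply, Finset.mul_sum]
  rw [h1, Finset.sum_eq_single x]
  · simp
  · intro y _ hy
    rw [sphOp_eq_zero hm (by omega) (by omega) (fun h => hy (Fin.ext h)) hf, Pi.zero_apply,
      mul_zero]
  · simp

variable (F V) in
/-- The projector onto `V_x` along the other constituents. -/
def projOp (m x : ℕ) : (Gr F V m → ℂ) →ₗ[ℂ] (Gr F V m → ℂ) :=
  (qPrefactor (Nat.card F) (finrank F V) m x : ℂ) • sphOp F V m x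

theorem projOp_mem_irrepV {m x : ℕ} (hm : 2 * m ≤ finrank F V) (hx : x ≤ m) (f : Gr F V m → ℂ) :
    projOp F V m x f ∈ (irrepV F V m x).toSubmodule :=
  Submodule.smul_mem _ _ (sphOp_mem_irrepV hm hx f)

theorem projOp_eq_zero {m x y : ℕ} (hm : 2 * m ≤ finrank F V) (hx : x ≤ m) (hy : y ≤ m)
    (hxy : x ≠ y) {f : Gr F V m → ℂ} (hf : f ∈ (irrepV F V m y).toSubmodule) :
    projOp F V m x f = 0 := by
  rw [projOp, LinearMap.smul_apply, sphOp_eq_zero hm hx hy hxy hf, smul_zero]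

/-- The normalization of the projector is found by comparing its trace with `dim V_x`. -/
theorem projOp_eq_self {m x : ℕ} (hm : 2 * m ≤ finrank F V) (hx : x ≤ m) {f : Gr F V m → ℂ}
    (hf : f ∈ (irrepV F V m x).toSubmodule) : projOp F V m x f = f := by
  classical
  obtain ⟨c, hc⟩ := exists_smul_sphOp_eq (F := F) (V := V) hm
  have hproj : LinearMap.IsProj (irrepV F V m x).toSubmodule (c ⟨x, by omega⟩ • sphOp F V m x) :=
    ⟨fun f => Submodule.smul_mem _ _ (sphOp_mem_irrepV hm hx f), hc ⟨x, by omega⟩⟩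
  have htr := hproj.trace
  rw [trace_eq_sum_single, Finset.sum_congr rfl (g := fun _ => c ⟨x, by omega⟩) fun W _ => by
    rw [LinearMap.smul_apply, Pi.smul_apply, sphOp_apply, Finset.sum_eq_single W
      (fun W' _ h => by rw [Pi.single_eq_of_ne h, mul_zero]) (by simp), sphFun_self]
    simp, Finset.sum_const, nsmul_eq_mul, Finset.card_univ] at htr
  have hpos : 0 < qBinom (Nat.card F) (finrank F V) m :=
    qBinom_pos one_lt_natCard_field (by omega)
  have hceq : c ⟨x, by omega⟩ = (qPrefactor (Nat.card F) (finrank F V) m x : ℂ) := by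
    have h1 := finrank_irrepV (F := F) (V := V) hx hm
    have h2 : ((Fintype.card (Gr F V m) : ℝ) : ℂ) * c ⟨x, by omega⟩ =
        ((finrank ℂ (irrepV F V m x).toSubmodule : ℝ) : ℂ) := by exact_mod_cast htr
    rw [card_Gr, h1] at h2
    have h3 : (qBinom (Nat.card F) (finrank F V) m : ℂ) ≠ 0 := by exact_mod_cast hpos.ne'
    refine mul_left_cancel₀ h3 (h2.trans ?_)
    rw [qPrefactor, ← Complex.ofReal_mul]
    refine congrArg _ ?_
    field_simp
  rw [projOp, ← hceq]
  exact hc ⟨x, by omega⟩ f hf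

/-- An element of `V_x` that depends only on the distance to `U` is a multiple of the spherical
function centred at `U`. -/
theorem eq_smul_sphFun_of_radial {m x : ℕ} (hm : 2 * m ≤ finrank F V) (hx : x ≤ m)
    {f : Gr F V m → ℂ} (hf : f ∈ (irrepV F V m x).toSubmodule) (U : Gr F V m)
    (hrad : ∀ W W' : Gr F V m, finrank F ↥(U.1 ⊓ W.1) = finrank F ↥(U.1 ⊓ W'.1) → f W = f W') :
    f = f U • fun W => (sphFun x U W : ℂ) := by
  classical
  obtain ⟨ψ, hψ⟩ : ∃ ψ : ℕ → ℂ, ∀ W, ψ (m - finrank F ↥(U.1 ⊓ W.1)) = f W := by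
    refine ⟨fun i => if h : ∃ W : Gr F V m, m - finrank F ↥(U.1 ⊓ W.1) = i then f h.choose else 0,
      fun W => ?_⟩
    have h : ∃ W' : Gr F V m, m - finrank F ↥(U.1 ⊓ W'.1) = m - finrank F ↥(U.1 ⊓ W.1) := ⟨W, rfl⟩
    refine (dif_pos h).trans (hrad _ _ ?_)
    have := h.choose_spec
    have := finrank_inf_le U W
    have := finrank_inf_le U h.choose
    omega
  obtain ⟨c, hc⟩ := exists_eq_sum_sphFun (F := F) (V := V) hm ψ
  have h1 : f = ∑ y : Fin (m + 1), c y • fun W => (sphFun y U W : ℂ) := by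
    ext W
    rw [← hψ, hc, Finset.sum_apply]
    rfl
  have h2 : f = c ⟨x, by omega⟩ • fun W => (sphFun x U W : ℂ) := by
    rw [← projOp_eq_self hm hx hf]
    conv_lhs => rw [h1]
    rw [map_sum, Finset.sum_eq_single ⟨x, by omega⟩]
    · rw [map_smul, projOp_eq_self hm hx (sphFun_mem_irrepV hm hx U)]
    · intro y _ hy
      rw [map_smul, projOp_eq_zero hm hx (by omega) (fun h => hy (Fin.ext h.symm))
        (sphFun_mem_irrepV hm (by omega) U), smul_zero]
    · simp
  have h3 : f U = c ⟨x, by omega⟩ := by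
    rw [h2]
    simp [sphFun_self]
  rw [h3]
  exact h2

instance stabilizerFintype {m : ℕ} (U : Gr F V m) :
    Fintype (MulAction.stabilizer (V ≃ₗ[F] V) U) := Fintype.ofFinite _

/-- Averaging over the stabilizer of `U` turns an element of `V_x` into a multiple of the
spherical function centred at `U`. -/
theorem sum_stabilizer_permRep {m x : ℕ} (hm : 2 * m ≤ finrank F V) (hx : x ≤ m)
    {f : Gr F V m → ℂ} (hf : f ∈ (irrepV F V m x).toSubmodule) (U : Gr F V m) :
    ∑ κ : MulAction.stabilizer (V ≃ₗ[F] V) U, permRep F V m κ f =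
      (Nat.card (MulAction.stabilizer (V ≃ₗ[F] V) U) * f U) • fun W => (sphFun x U W : ℂ) := by
  set f' := ∑ κ : MulAction.stabilizer (V ≃ₗ[F] V) U, permRep F V m κ f with hf'
  have hval : ∀ W, f' W = ∑ κ : MulAction.stabilizer (V ≃ₗ[F] V) U, f ((κ : V ≃ₗ[F] V)⁻¹ • W) :=
    fun W => by rw [hf', Finset.sum_apply]; rfl
  have hmem : f' ∈ (irrepV F V m x).toSubmodule :=
    Submodule.sum_mem _ fun κ _ => (irrepV F V m x).apply_mem_toSubmodule κ hf
  have hU : f' U = Nat.card (MulAction.stabilizer (V ≃ₗ[F] V) U) * f U := by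
    rw [hval, Finset.sum_congr rfl (g := fun _ => f U) fun κ _ => by
      rw [inv_smul_eq_iff.2 (MulAction.mem_stabilizer_iff.1 κ.2).symm], Finset.sum_const,
      nsmul_eq_mul, Finset.card_univ, Nat.card_eq_fintype_card]
  rw [← hU]
  refine eq_smul_sphFun_of_radial hm hx hmem U fun W W' h => ?_
  obtain ⟨g, hg, rfl⟩ := exists_smul_eq_smul_eq h
  have hg' : g ∈ MulAction.stabilizer (V ≃ₗ[F] V) U := hg
  rw [hval, hval]
  refine Fintype.sum_equiv (Equiv.mulLeft ⟨g, hg'⟩) _ _ fun κ => ?_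
  rw [Equiv.coe_mulLeft, Subgroup.coe_mul, mul_inv_rev, mul_smul, inv_smul_smul]

/-- A nonzero subrepresentation contains, by averaging, one spherical function, hence all its
translates, and these span `V_x`. -/
theorem isIrreducible_irrepRep {m x : ℕ} (hm : 2 * m ≤ finrank F V) (hx : x ≤ m) :
    (irrepRep F V m x).IsIrreducible := by
  obtain ⟨U₀⟩ := nonempty_Gr (F := F) (V := V) (m := m) (by omega)
  let s : Gr F V m → (irrepV F V m x).toSubmodule := fun U =>
    ⟨fun W => (sphFun x U W : ℂ), sphFun_mem_irrepV hm hx U⟩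
  have hs0 : s U₀ ≠ 0 := fun h => by
    have h1 : (sphFun x U₀ U₀ : ℂ) = 0 := congrFun (congrArg Subtype.val h) U₀
    rw [sphFun_self] at h1
    exact one_ne_zero (Complex.ofReal_eq_zero.1 h1)
  have hnt : Nontrivial (Subrepresentation (irrepRep F V m x)) :=
    ⟨⊥, ⊤, fun h => hs0 (by
      have h1 : s U₀ ∈ (⊥ : Subrepresentation (irrepRep F V m x)).toSubmodule := by
        rw [h]; exact Submodule.mem_top (R := ℂ)
      exact (Submodule.mem_bot ℂ).1 h1)⟩
  refine { toNontrivial := hnt, eq_bot_or_eq_top := fun σ => ?_ }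
  by_cases hσ : ∃ f ∈ σ.toSubmodule, f ≠ 0
  · right
    obtain ⟨f, hf, hf0⟩ := hσ
    obtain ⟨U, hU⟩ : ∃ U, f.1 U ≠ 0 := by
      by_contra! h
      exact hf0 (Subtype.ext (funext h))
    have hcard : (Nat.card (MulAction.stabilizer (V ≃ₗ[F] V) U) : ℂ) ≠ 0 :=
      Nat.cast_ne_zero.2 Nat.card_pos.ne'
    have hsU : s U ∈ σ.toSubmodule := by
      have h1 : ∑ κ : MulAction.stabilizer (V ≃ₗ[F] V) U, irrepRep F V m x κ f =
          (Nat.card (MulAction.stabilizer (V ≃ₗ[F] V) U) * f.1 U) • s U := by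
        refine Subtype.ext ?_
        rw [Submodule.coe_sum]
        exact sum_stabilizer_permRep hm hx f.2 U
      have h2 : (Nat.card (MulAction.stabilizer (V ≃ₗ[F] V) U) * f.1 U) • s U ∈ σ.toSubmodule := by
        rw [← h1]
        exact Submodule.sum_mem _ fun κ _ => σ.apply_mem_toSubmodule _ hf
      exact (Submodule.smul_mem_iff _ (mul_ne_zero hcard hU)).1 h2
    have hsW : ∀ W, s W ∈ σ.toSubmodule := fun W => by
      obtain ⟨g, rfl⟩ := exists_smul_eq U W
      have h1 : s (g • U) = irrepRep F V m x g (s U) :=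
        Subtype.ext (permRep_sphFun x g U).symm
      rw [h1]
      exact σ.apply_mem_toSubmodule g hsU
    refine Subrepresentation.toSubmodule_injective (eq_top_iff.2 fun h _ => ?_)
    have h1 : h = (qPrefactor (Nat.card F) (finrank F V) m x : ℂ) • ∑ W, h.1 W • s W := by
      refine Subtype.ext ?_
      conv_lhs => rw [← projOp_eq_self hm hx h.2, projOp, LinearMap.smul_apply, sphOp_eq_sum]
      rw [Submodule.coe_smul, Submodule.coe_sum]
      rfl
    rw [h1]
    exact Submodule.smul_mem _ _ (Submodule.sum_mem _ fun W _ => Submodule.smul_mem _ _ (hsW W))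
  · left
    push Not at hσ
    exact Subrepresentation.toSubmodule_injective ((Submodule.eq_bot_iff _).2 hσ)

theorem character_irrepRep {m x : ℕ} (hm : 2 * m ≤ finrank F V) (hx : x ≤ m) (g : V ≃ₗ[F] V) :
    (irrepRep F V m x).character g =
      ((qPrefactor (Nat.card F) (finrank F V) m x * ∑ W : Gr F V m, sphFun x (g⁻¹ • W) W : ℝ) : ℂ) := by
  classical
  have hmem : ∀ f, (permRep F V m g ∘ₗ projOp F V m x) f ∈ (irrepV F V m x).toSubmodule := fun f =>
    (irrepV F V m x).apply_mem_toSubmodule g (projOp_mem_irrepV hm hx f)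
  have h1 := LinearMap.trace_restrict_eq_of_forall_mem (irrepV F V m x).toSubmodule
    (permRep F V m g ∘ₗ projOp F V m x) hmem
  have h2 : (permRep F V m g ∘ₗ projOp F V m x).restrict (fun f _ => hmem f) =
      irrepRep F V m x g := by
    ext f : 1
    refine Subtype.ext ?_
    exact congrArg (permRep F V m g) (projOp_eq_self hm hx f.2)
  rw [Representation.character, ← h2, h1, trace_eq_sum_single]
  push_cast
  rw [Finset.mul_sum]
  refine Finset.sum_congr rfl fun W _ => ?_
  rw [Function.comp_apply, permRep_apply, projOp, LinearMap.smul_apply, Pi.smul_apply,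
    smul_eq_mul, sphOp_apply, Finset.sum_eq_single W
      (fun W' _ h => by rw [Pi.single_eq_of_ne h, mul_zero]) (by simp), Pi.single_eq_same, mul_one]

theorem zonalSpherical_eq_sphFun {m x : ℕ} (hm : 2 * m ≤ finrank F V) (hx : x ≤ m)
    (U : Gr F V m) (g : V ≃ₗ[F] V) : zonalSpherical U x g = (sphFun x U (g • U) : ℂ) := by
  have hcard : (Nat.card (MulAction.stabilizer (V ≃ₗ[F] V) U) : ℂ) ≠ 0 :=
    Nat.cast_ne_zero.2 Nat.card_pos.ne'
  have h1 : zonalSpherical U x g = (Nat.card (MulAction.stabilizer (V ≃ₗ[F] V) U) : ℂ)⁻¹ *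
      ∑ κ : MulAction.stabilizer (V ≃ₗ[F] V) U,
        conj ((irrepRep F V m x).character (g * (κ : V ≃ₗ[F] V)⁻¹)) := rfl
  rw [h1, inv_mul_eq_iff_eq_mul₀ hcard]
  have h2 : ∀ W : Gr F V m, ∑ κ : MulAction.stabilizer (V ≃ₗ[F] V) U,
      (sphFun x ((g * (κ : V ≃ₗ[F] V)⁻¹)⁻¹ • W) W : ℂ) =
      Nat.card (MulAction.stabilizer (V ≃ₗ[F] V) U) *
        ((sphFun x (g • U) W : ℂ) * (sphFun x U W : ℂ)) := fun W => by
    have h3 := congrFun (sum_stabilizer_permRep hm hx (sphFun_mem_irrepV hm hx W) U) (g⁻¹ • W)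
    rw [Finset.sum_apply, Pi.smul_apply, smul_eq_mul, ← sphFun_smul x g U, smul_inv_smul,
      sphFun_comm x W U] at h3
    rw [mul_comm (sphFun x (g • U) W : ℂ), ← mul_assoc, ← h3]
    refine Fintype.sum_equiv (Equiv.inv _) _ _ fun κ => ?_
    rw [permRep_apply, Equiv.inv_apply, Subgroup.coe_inv, mul_inv_rev, inv_inv, mul_smul,
      sphFun_comm]
  simp only [character_irrepRep hm hx, Complex.conj_ofReal]
  push_cast
  rw [← Finset.mul_sum, Finset.sum_comm]
  simp only [h2]
  have h4 := congrFun (projOp_eq_self hm hx (sphFun_mem_irrepV hm hx U)) (g • U)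
  rw [projOp, LinearMap.smul_apply, Pi.smul_apply, smul_eq_mul, sphOp_apply] at h4
  rw [← h4, ← Finset.mul_sum]
  ring

end Projector

end

noncomputable section

/-! ### Invariant operators on functions on the Grassmannian -/

section Invariant

open Module

variable {F : Type*} [Field F] {V : Type*} [AddCommGroup V] [Module F V]

open Classical in
theorem permRep_single {m : ℕ} (g : V ≃ₗ[F] V) (W : Gr F V m) :
    permRep F V m g (Pi.single W 1) = Pi.single (g • W) 1 := by
  ext W'
  rw [permRep_apply, Pi.single_apply, Pi.single_apply]
  exact if_congr (inv_smul_eq_iff) rfl rfl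

variable [Finite F] [FiniteDimensional F V]

open Classical in
/-- The kernel of an invariant operator depends only on the dimension of the intersection of its
two arguments, so it is symmetric. -/
theorem isSymm_toMatrix' {m : ℕ} {K : (Gr F V m → ℂ) →ₗ[ℂ] (Gr F V m → ℂ)}
    (hK : ∀ g f, K (permRep F V m g f) = permRep F V m g (K f)) :
    (LinearMap.toMatrix' K).IsSymm := by
  ext W W'
  obtain ⟨g, h1, h2⟩ := exists_smul_eq_smul_eq (W₁ := W) (W₂ := W') (W₁' := W') (W₂' := W)
    (by rw [inf_comm])
  rw [Matrix.transpose_apply, LinearMap.toMatrix'_apply, LinearMap.toMatrix'_apply]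
  have h3 := congrFun (hK g (Pi.single W' 1)) (g • W)
  rw [permRep_single, permRep_apply, inv_smul_smul, h2, h1] at h3
  exact h3

/-- The algebra of invariant operators is commutative (Gelfand's trick). -/
theorem comp_comm_of_invariant {m : ℕ} {K L : (Gr F V m → ℂ) →ₗ[ℂ] (Gr F V m → ℂ)}
    (hK : ∀ g f, K (permRep F V m g f) = permRep F V m g (K f))
    (hL : ∀ g f, L (permRep F V m g f) = permRep F V m g (L f)) : K ∘ₗ L = L ∘ₗ K := by
  classical
  have hKL : ∀ g f, (K ∘ₗ L) (permRep F V m g f) = permRep F V m g ((K ∘ₗ L) f) := fun g f => by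
    rw [LinearMap.comp_apply, LinearMap.comp_apply, hL, hK]
  apply LinearMap.toMatrix'.injective
  rw [← (isSymm_toMatrix' hKL).eq, LinearMap.toMatrix'_comp, Matrix.transpose_mul,
    (isSymm_toMatrix' hK).eq, (isSymm_toMatrix' hL).eq, LinearMap.toMatrix'_comp]

theorem projOp_permRep {m : ℕ} (x : ℕ) (g : V ≃ₗ[F] V) (f : Gr F V m → ℂ) :
    projOp F V m x (permRep F V m g f) = permRep F V m g (projOp F V m x f) := by
  rw [projOp, LinearMap.smul_apply, LinearMap.smul_apply, map_smul]
  congr 1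
  ext U
  rw [permRep_apply, sphOp_apply, sphOp_apply]
  refine Fintype.sum_equiv (MulAction.toPerm g⁻¹) _ _ fun W => ?_
  rw [MulAction.toPerm_apply, sphFun_smul, permRep_apply]

theorem sum_conj_projOp_mul {m x : ℕ} (f g : Gr F V m → ℂ) :
    ∑ W, conj (projOp F V m x f W) * g W = ∑ W, conj (f W) * projOp F V m x g W := by
  simp only [projOp, LinearMap.smul_apply, Pi.smul_apply, smul_eq_mul, sphOp_apply, map_sum,
    map_mul, Finset.sum_mul, Finset.mul_sum, Complex.conj_ofReal]
  rw [Finset.sum_comm]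
  refine Finset.sum_congr rfl fun W _ => Finset.sum_congr rfl fun W' _ => ?_
  rw [sphFun_comm]
  ring

/-- `V_x` occurs in `1_K^G` only once: every intertwiner from `V_x` to `1_K^G` has its image
in `V_x`. -/
theorem intertwiner_mem_irrepV {m x : ℕ} (hm : 2 * m ≤ finrank F V) (hx : x ≤ m)
    (Φ : (irrepV F V m x).toSubmodule →ₗ[ℂ] (Gr F V m → ℂ))
    (hΦ : ∀ g f, Φ (irrepRep F V m x g f) = permRep F V m g (Φ f))
    (f : (irrepV F V m x).toSubmodule) : Φ f ∈ (irrepV F V m x).toSubmodule := by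
  set K := Φ ∘ₗ (projOp F V m x).codRestrict _ (projOp_mem_irrepV hm hx) with hKdef
  have hK : ∀ g f, K (permRep F V m g f) = permRep F V m g (K f) := fun g f => by
    rw [hKdef, LinearMap.comp_apply, LinearMap.comp_apply, ← hΦ]
    exact congrArg Φ (Subtype.ext (projOp_permRep x g f))
  have hKf : K f.1 = Φ f :=
    congrArg Φ (Subtype.ext (projOp_eq_self hm hx f.2))
  have h : K (projOp F V m x f.1) = projOp F V m x (K f.1) :=
    LinearMap.congr_fun (comp_comm_of_invariant hK (projOp_permRep x)) f.1
  rw [projOp_eq_self hm hx f.2, hKf] at h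
  rw [h]
  exact projOp_mem_irrepV hm hx _

end Invariant

/-! ### The copy of `1_K^G` in the tensor power -/

section TensorCopy

open Module

variable {F : Type*} [Field F] {V : Type*} [AddCommGroup V] [Module F V]

theorem QubitTensor.induction_on {ι : Type*} {p : QubitTensor ι → Prop} (t : QubitTensor ι)
    (smul_pure : ∀ (c : ℂ) (t : ι → Qubit), p (c • QubitTensor.pure t))
    (add : ∀ s t, p s → p t → p (s + t)) : p t :=
  PiTensorProduct.induction_on t smul_pure add

theorem QubitTensor.inner_perm_pure {ι : Type*} [Fintype ι] (σ : Equiv.Perm ι) (s : ι → Qubit)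
    (t : QubitTensor ι) :
    inner ℂ (QubitTensor.perm σ (QubitTensor.pure s)) (QubitTensor.perm σ t) =
      inner ℂ (QubitTensor.pure s) t := by
  induction t using QubitTensor.induction_on with
  | smul_pure c t =>
    rw [map_smul, inner_smul_right, inner_smul_right, QubitTensor.perm_pure, QubitTensor.perm_pure,
      QubitTensor.inner_pure, QubitTensor.inner_pure]
    congr 1
    exact Equiv.prod_comp σ.symm fun L => inner ℂ (s L) (t L)
  | add t u ht hu =>
    rw [map_add, inner_add_right, inner_add_right, ht, hu]

variable [Finite F] [FiniteDimensional F V]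

theorem inner_lineRep_eKet (g : V ≃ₗ[F] V) (W : Submodule F V) (t : QubitTensor (Lines F V)) :
    inner ℂ (lineRep F V g (eKet W)) (lineRep F V g t) = inner ℂ (eKet W) t :=
  QubitTensor.inner_perm_pure _ _ t

theorem inner_ket_one_zero : inner ℂ (ket 1) (ket 0) = (0 : ℂ) := by
  simp [PiLp.inner_apply]

theorem inner_eKet_of_ne {W W' : Submodule F V} (h : ¬ W ≤ W') :
    inner ℂ (eKet W) (eKet W') = 0 := by
  classical
  obtain ⟨v, hv, hv'⟩ := SetLike.not_le_iff_exists.1 h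
  have hv0 : v ≠ 0 := fun h0 => hv' (h0 ▸ W'.zero_mem)
  -- the line spanned by `v` is a factor where the two vectors are orthogonal
  refine (QubitTensor.inner_pure _ _).trans
    (Finset.prod_eq_zero (Finset.mem_univ ⟨Submodule.span F {v}, finrank_span_singleton hv0⟩) ?_)
  rw [if_pos (by simpa using hv), if_neg (by simpa using hv')]
  exact inner_ket_one_zero

open Classical in
theorem inner_eKet {m : ℕ} (W W' : Gr F V m) :
    inner ℂ (eKet W.1) (eKet W'.1) = if W = W' then (1 : ℂ) else 0 := by
  split_ifs with h
  · subst h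
    refine (QubitTensor.inner_pure _ _).trans (Finset.prod_eq_one fun L _ => ?_)
    split_ifs <;> simp
  · exact inner_eKet_of_ne fun hle => h (Subtype.ext
      (Submodule.eq_of_le_of_finrank_eq hle (W.2.trans W'.2.symm)))

variable (F V) in
/-- The isometric embedding of `1_K^G` into the tensor power that sends the point mass at `W`
to `|e_W⟩`. -/
def grKet (m : ℕ) : (Gr F V m → ℂ) →ₗ[ℂ] QubitTensor (Lines F V) :=
  Fintype.linearCombination ℂ fun W => eKet W.1

theorem grKet_apply {m : ℕ} (f : Gr F V m → ℂ) : grKet F V m f = ∑ W, f W • eKet W.1 := rfl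

theorem lineRep_grKet {m : ℕ} (g : V ≃ₗ[F] V) (f : Gr F V m → ℂ) :
    lineRep F V g (grKet F V m f) = grKet F V m (permRep F V m g f) := by
  rw [grKet_apply, grKet_apply, map_sum]
  refine Fintype.sum_equiv (MulAction.toPerm g) _ _ fun W => ?_
  rw [map_smul, lineRep_eKet, MulAction.toPerm_apply, permRep_apply, inv_smul_smul, Gr.smul_val]

theorem inner_grKet_left {m : ℕ} (f : Gr F V m → ℂ) (t : QubitTensor (Lines F V)) :
    inner ℂ (grKet F V m f) t = ∑ W, conj (f W) * inner ℂ (eKet W.1) t := by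
  rw [grKet_apply, sum_inner]
  exact Finset.sum_congr rfl fun W _ => inner_smul_left _ _ _

theorem inner_eKet_grKet {m : ℕ} (W : Gr F V m) (f : Gr F V m → ℂ) :
    inner ℂ (eKet W.1) (grKet F V m f) = f W := by
  classical
  rw [grKet_apply, inner_sum, Finset.sum_eq_single W]
  · rw [inner_smul_right, inner_eKet, if_pos rfl, mul_one]
  · intro W' _ h
    rw [inner_smul_right, inner_eKet, if_neg h.symm, mul_zero]
  · simp

theorem grKet_injective (m : ℕ) : Function.Injective (grKet F V m) := fun f g h => by
  ext W
  rw [← inner_eKet_grKet W f, h, inner_eKet_grKet]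

variable (F V) in
/-- The adjoint of `grKet`. -/
def grBra (m : ℕ) : QubitTensor (Lines F V) →ₗ[ℂ] (Gr F V m → ℂ) where
  toFun t W := inner ℂ (eKet W.1) t
  map_add' s t := by ext W; exact inner_add_right _ _ _
  map_smul' c t := by ext W; exact inner_smul_right _ _ _

theorem grBra_lineRep {m : ℕ} (g : V ≃ₗ[F] V) (t : QubitTensor (Lines F V)) :
    grBra F V m (lineRep F V g t) = permRep F V m g (grBra F V m t) := by
  ext W
  have h := inner_lineRep_eKet g (g⁻¹ • W).1 t
  rw [lineRep_eKet, ← Gr.smul_val, smul_inv_smul] at h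
  exact h

theorem grKet_mem_isotypicPart {m x : ℕ} {f : Gr F V m → ℂ}
    (hf : f ∈ (irrepV F V m x).toSubmodule) :
    grKet F V m f ∈ isotypicPart (lineRep F V) (irrepRep F V m x) := by
  let σ : Subrepresentation (lineRep F V) :=
    { toSubmodule := (irrepV F V m x).toSubmodule.map (grKet F V m)
      apply_mem_toSubmodule := by
        rintro g _ ⟨f, hf, rfl⟩
        exact ⟨_, (irrepV F V m x).apply_mem_toSubmodule g hf, (lineRep_grKet g f).symm⟩ }
  let e : (irrepV F V m x).toSubmodule ≃ₗ[ℂ] σ.toSubmodule :=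
    Submodule.equivMapOfInjective (grKet F V m) (grKet_injective m) _
  have hσ : Nonempty (Representation.Equiv σ.toRepresentation (irrepRep F V m x)) := by
    refine ⟨(Representation.Equiv.mk e fun g => ?_).symm⟩
    refine LinearMap.ext fun f => Subtype.ext ?_
    exact (lineRep_grKet g f.1).symm
  exact (le_iSup₂ (f := fun (σ : Subrepresentation (lineRep F V))
    (_ : Nonempty (Representation.Equiv σ.toRepresentation (irrepRep F V m x))) => σ.toSubmodule)
    σ hσ) ⟨f, hf, rfl⟩

/-- The adjoint of the embedding maps the isotypic component to `V_x`, since `V_x` occurs only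
once in `1_K^G`. -/
theorem grBra_mem_irrepV {m x : ℕ} (hm : 2 * m ≤ finrank F V) (hx : x ≤ m)
    {t : QubitTensor (Lines F V)}
    (ht : t ∈ isotypicPart (lineRep F V) (irrepRep F V m x)) :
    grBra F V m t ∈ (irrepV F V m x).toSubmodule := by
  suffices h : isotypicPart (lineRep F V) (irrepRep F V m x) ≤
      (irrepV F V m x).toSubmodule.comap (grBra F V m) from h ht
  refine iSup₂_le fun σ hσ t ht => ?_
  obtain ⟨e⟩ := hσ
  let e' : σ.toSubmodule ≃ₗ[ℂ] (irrepV F V m x).toSubmodule := e.toLinearEquiv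
  have he : ∀ g s, e' (σ.toRepresentation g s) = irrepRep F V m x g (e' s) := fun g s =>
    LinearMap.congr_fun (e.toIntertwiningMap.isIntertwining' g) s
  have h := intertwiner_mem_irrepV hm hx
    (grBra F V m ∘ₗ σ.toSubmodule.subtype ∘ₗ e'.symm.toLinearMap) (fun g f => ?_) (e' ⟨t, ht⟩)
  · simpa using h
  · have h1 : e'.symm (irrepRep F V m x g f) = σ.toRepresentation g (e'.symm f) := by
      rw [LinearEquiv.symm_apply_eq, he, LinearEquiv.apply_symm_apply]
    rw [LinearMap.comp_apply, LinearMap.comp_apply, LinearMap.comp_apply, LinearMap.comp_apply,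
      LinearEquiv.coe_coe, h1, ← grBra_lineRep]
    rfl

theorem isotypicProj_grKet {m x : ℕ} (hm : 2 * m ≤ finrank F V) (hx : x ≤ m)
    (f : Gr F V m → ℂ) :
    isotypicProj F V m x (grKet F V m f) = grKet F V m (projOp F V m x f) := by
  refine Submodule.eq_starProjection_of_mem_of_inner_eq_zero
    (grKet_mem_isotypicPart (projOp_mem_irrepV hm hx f)) fun t ht => ?_
  have h1 := grBra_mem_irrepV hm hx ht
  have h2 := sum_conj_projOp_mul (x := x) f (grBra F V m t)
  rw [projOp_eq_self hm hx h1] at h2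
  rw [inner_sub_left, inner_grKet_left, inner_grKet_left, sub_eq_zero]
  exact h2.symm

open Classical in
theorem xiKet_eq {n m k l : ℕ} (v : Basis (Fin n) F V) : xiKet v m k l =
    (((Real.sqrt (qBinom (Nat.card F) (n - k) (m - l)))⁻¹ : ℝ) : ℂ) •
      grKet F V m fun W => if W ∈ grSubset v m k l then 1 else 0 := by
  rw [xiKet, grKet_apply]
  congr 1
  refine Finset.sum_congr rfl fun W _ => ?_
  split_ifs <;> simp

open Classical in
/-- `p̃` is the kernel of the projector onto `V_x`, summed over one argument and averaged over the
other, where both run through `Gr(n,m|k,l)`. -/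
theorem pTilde_eq_sum {n m k l x : ℕ} (v : Basis (Fin n) F V) (hm : 2 * m ≤ n) (hx : x ≤ m)
    (hN : m - l ≤ n - k) :
    pTilde v m k l x = (((qBinom (Nat.card F) (n - k) (m - l))⁻¹ * (qPrefactor (Nat.card F) n m x *
      ∑ W : Gr F V m with W ∈ grSubset v m k l, ∑ W' : Gr F V m with W' ∈ grSubset v m k l,
        sphFun x W W') : ℝ) : ℂ) := by
  have hn : finrank F V = n := by rw [finrank_eq_card_basis v, Fintype.card_fin]
  have hpos : 0 < qBinom (Nat.card F) (n - k) (m - l) :=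
    qBinom_pos (one_lt_natCard_field (F := F)) hN
  rw [pTilde, xiKet_eq, map_smul, inner_smul_left, inner_smul_right, Complex.conj_ofReal,
    isotypicProj_grKet (by rw [hn]; exact hm) hx, inner_grKet_left, ← mul_assoc,
    ← Complex.ofReal_mul, ← mul_inv, Real.mul_self_sqrt hpos.le, Complex.ofReal_mul]
  congr 1
  simp only [inner_eKet_grKet, projOp, LinearMap.smul_apply, Pi.smul_apply, smul_eq_mul,
    sphOp_apply, hn]
  rw [Complex.ofReal_mul, Complex.ofReal_sum, Finset.mul_sum, Finset.sum_filter]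
  refine Finset.sum_congr rfl fun W _ => ?_
  split_ifs with h
  · rw [map_one, one_mul, Finset.sum_filter]
    push_cast
    congr 1
    refine Finset.sum_congr rfl fun W' _ => ?_
    split_ifs <;> simp
  · simp

theorem pTilde_re_nonneg {n : ℕ} (v : Basis (Fin n) F V) (m k l x : ℕ) :
    0 ≤ (pTilde v m k l x).re := by
  have h := Submodule.re_inner_starProjection_nonneg (𝕜 := ℂ)
    (K := isotypicPart (lineRep F V) (irrepRep F V m x)) (xiKet v m k l)
  rw [← inner_conj_symm, RCLike.conj_re] at h
  exact h

end TensorCopy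

end

noncomputable section

/-! ### Distances between the members of an interval of subspaces -/

section QBinomial

variable {q : ℝ}

theorem qInt_sub_qInt (q : ℝ) {a b : ℕ} (h : b ≤ a) :
    qInt q a - qInt q b = q ^ b * qInt q (a - b) := by
  obtain ⟨c, rfl⟩ := Nat.exists_eq_add_of_le h
  rw [qInt_add, Nat.add_sub_cancel_left]
  ring

theorem qBinom_symm_of_le {a s : ℕ} (h : s ≤ a) : qBinom q a (a - s) = qBinom q a s := by
  rw [qBinom, qBinom, if_pos h, if_pos (Nat.sub_le a s), Nat.sub_sub_self h, mul_comm]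

theorem qBinom_eq_zero {a s : ℕ} (h : a < s) : qBinom q a s = 0 := if_neg (by omega)

/-- The subtracted `q`-integer in the counting products factors out as a power of `q`; if `M`
exceeds `a`, both sides contain a vanishing factor. -/
theorem prod_qInt_sub_div (hq : 1 < q) (a b M : ℕ) :
    ∏ j ∈ Finset.range M, (qInt q (a + b - j) - qInt q b) / qInt q (j + 1) =
      q ^ (b * M) * qBinom q a M := by
  by_cases h : M ≤ a
  · rw [pow_mul, ← Finset.card_range M, ← Finset.prod_const, Finset.card_range,
      ← prod_qInt_div_eq_qBinom hq, ← Finset.prod_mul_distrib]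
    refine Finset.prod_congr rfl fun j hj => ?_
    rw [Finset.mem_range] at hj
    rw [qInt_sub_qInt q (by omega), mul_div_assoc]
    congr 3
    omega
  · rw [not_le] at h
    rw [qBinom_eq_zero h, mul_zero]
    refine Finset.prod_eq_zero (Finset.mem_range.2 h) ?_
    rw [Nat.add_sub_cancel_left, sub_self, zero_div]

theorem qBinom_succ_left_mul (hq : 1 < q) {a M : ℕ} (h : M ≤ a) :
    qBinom q (a + 1) M * qInt q (a + 1 - M) = qInt q (a + 1) * qBinom q a M := by
  obtain ⟨b, rfl⟩ := Nat.exists_eq_add_of_le h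
  rw [qBinom, qBinom, if_pos (by omega), if_pos h, Nat.add_sub_cancel_left,
    show M + b + 1 - M = b + 1 by omega, qFact_succ, qFact_succ]
  have h1 := (qFact_pos hq M).ne'
  have h2 := (qFact_pos hq b).ne'
  have h3 := (qInt_pos hq b.succ_pos).ne'
  field_simp

theorem one_sub_zpow_neg_mul (hq : 1 < q) {a r : ℕ} (h : r ≤ a) :
    1 - q ^ (-(a : ℤ)) * q ^ r = (q - 1) * qInt q (a - r) / q ^ (a - r) := by
  obtain ⟨b, rfl⟩ := Nat.exists_eq_add_of_le h
  have hq0 : q ≠ 0 := by linarith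
  rw [Nat.add_sub_cancel_left, sub_one_mul_qInt, zpow_neg, zpow_natCast, pow_add]
  have h1 : q ^ r ≠ 0 := pow_ne_zero _ hq0
  have h2 : q ^ b ≠ 0 := pow_ne_zero _ hq0
  field_simp

theorem qPoch_zpow_neg_ne_zero (hq : 1 < q) {a r : ℕ} (h : r ≤ a) :
    qPoch (q ^ (-(a : ℤ))) q r ≠ 0 := by
  refine Finset.prod_ne_zero_iff.2 fun j hj => ?_
  rw [Finset.mem_range] at hj
  rw [one_sub_zpow_neg_mul hq (by omega)]
  have h1 : 0 < q - 1 := by linarith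
  have h2 := qInt_pos hq (show 0 < a - j by omega)
  positivity

/-- Removing `r` from the upper index of a `q`-binomial produces two shifted factorials; both sides
vanish for `r > N`. -/
theorem pow_mul_qBinom_sub (hq : 1 < q) {M N r : ℕ} (hr : r ≤ M + N) :
    q ^ (r * M) * qBinom q (M + N - r) M = qBinom q (M + N) M *
      (qPoch (q ^ (-(N : ℤ))) q r / qPoch (q ^ (-((M + N : ℕ) : ℤ))) q r) := by
  have hq0 : q ≠ 0 := by linarith
  by_cases h : r ≤ N
  · rw [mul_div_assoc', eq_div_iff (qPoch_zpow_neg_ne_zero hq hr)]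
    induction r with
    | zero => simp [qPoch]
    | succ r ih =>
      specialize ih (by omega) (by omega)
      rw [qPoch_succ, qPoch_succ, ← mul_assoc, ← mul_assoc (qBinom q (M + N) M), ← ih,
        one_sub_zpow_neg_mul hq (show r ≤ N by omega),
        one_sub_zpow_neg_mul hq (show r ≤ M + N by omega)]
      have h1 := qBinom_succ_left_mul hq (a := M + N - (r + 1)) (M := M) (by omega)
      rw [show M + N - (r + 1) + 1 = M + N - r by omega, show M + N - r - M = N - r by omega] at h1
      have h2 : q ^ (M + N - r) = q ^ M * q ^ (N - r) := by
        rw [← pow_add]; congr 1; omega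
      have h3 : q ^ ((r + 1) * M) = q ^ (r * M) * q ^ M := by
        rw [← pow_add]; congr 1; ring
      rw [h2, h3]
      have h4 : q ^ M ≠ 0 := pow_ne_zero _ hq0
      have h5 : q ^ (N - r) ≠ 0 := pow_ne_zero _ hq0
      field_simp
      linear_combination (-(q - 1) * qPoch (q ^ (-((M + N : ℕ) : ℤ))) q r) * h1
  · rw [qPoch_inv_pow_eq_zero hq0 (by omega), qBinom_eq_zero (by omega)]
    simp

theorem qPoch_mul_prod (hq : 1 < q) {M i r : ℕ} (hi : i ≤ M) (hr : r ≤ M) :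
    (∏ j ∈ Finset.range r, (qInt q (M - j) - qInt q (M - i)) / qInt q (j + 1)) *
      qPoch (q ^ (-(M : ℤ))) q r = qBinom q M r * qPoch (q ^ (-(i : ℤ))) q r := by
  have hq0 : q ≠ 0 := by linarith
  rw [← prod_qInt_div_eq_qBinom hq, qPoch, qPoch, ← Finset.prod_mul_distrib,
    ← Finset.prod_mul_distrib]
  refine Finset.prod_congr rfl fun j hj => ?_
  rw [Finset.mem_range] at hj
  rw [one_sub_zpow_neg_mul hq (show j ≤ M by omega), qInt_sub_eq_div hq hi,
    qInt_sub_eq_div hq (show j ≤ M by omega), pow_sub₀ q hq0 (show j ≤ M by omega), zpow_neg,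
    zpow_natCast]
  have h1 : q ^ i ≠ 0 := pow_ne_zero _ hq0
  have h2 : q ^ j ≠ 0 := pow_ne_zero _ hq0
  have h3 : q ^ M ≠ 0 := pow_ne_zero _ hq0
  have h4 := (qInt_pos hq j.succ_pos).ne'
  have h5 : q - 1 ≠ 0 := by linarith
  field_simp
  ring

end QBinomial

section Interval

open Module

variable {F : Type*} [Field F] [Finite F] {V : Type*} [AddCommGroup V] [Module F V]
  [FiniteDimensional F V]

theorem mem_relDisj_self {P Z A : Submodule F V} {s : ℕ} :
    A ∈ relDisj P P Z s ↔ P ≤ A ∧ A ≤ Z ∧ finrank F A = finrank F P + s := by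
  rw [mem_relDisj]
  constructor
  · rintro ⟨h1, h2, h3, -⟩; exact ⟨h1, h2, h3⟩
  · rintro ⟨h1, h2, h3⟩; exact ⟨h1, h2, h3, inf_eq_right.2 h1⟩

theorem card_relDisj_self {P Z : Submodule F V} (h : P ≤ Z) (s : ℕ) :
    ((relDisj P P Z s).card : ℝ) =
      qBinom (Nat.card F) (finrank F Z - finrank F P) s := by
  have h1 := card_relDisj (C := P) (U := P) (Z := Z) le_rfl h s
  simp only [Nat.sub_self, qInt_zero, sub_zero] at h1
  rw [h1, prod_qInt_div_eq_qBinom one_lt_natCard_field]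

variable {P Z W : Submodule F V} {M N : ℕ}

theorem finrank_inf_add_le {W' : Submodule F V} (hW : W ∈ relDisj P P Z M)
    (hW' : W' ∈ relDisj P P Z M) :
    finrank F P ≤ finrank F ↥(W ⊓ W') ∧ finrank F ↥(W ⊓ W') ≤ finrank F P + M := by
  rw [mem_relDisj_self] at hW hW'
  exact ⟨Submodule.finrank_mono (le_inf hW.1 hW'.1),
    (Submodule.finrank_mono inf_le_left).trans hW.2.2.le⟩

open Classical in
/-- The number of `W'` in the interval at distance `i` from `W`: choose the intersection `W ∩ W'`
first. -/
theorem card_filter_finrank_inf (hZ : finrank F Z = finrank F P + (M + N))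
    (hW : W ∈ relDisj P P Z M) (i : ℕ) :
    (((relDisj P P Z M).filter
      fun W' => finrank F ↥(W ⊓ W') + i = finrank F P + M).card : ℝ) =
      (Nat.card F : ℝ) ^ i ^ 2 * qBinom (Nat.card F) M i * qBinom (Nat.card F) N i := by
  have hq : (1 : ℝ) < Nat.card F := one_lt_natCard_field
  obtain ⟨h1, h2, h3⟩ := mem_relDisj_self.1 hW
  by_cases hi : i ≤ M
  · rw [Finset.card_eq_sum_card_fiberwise (f := fun W' => W ⊓ W') (t := relDisj P P W (M - i))]
    · rw [Nat.cast_sum, Finset.sum_congr rfl (g := fun _ =>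
        (Nat.card F : ℝ) ^ i ^ 2 * qBinom (Nat.card F) N i), Finset.sum_const, nsmul_eq_mul,
        card_relDisj_self h1, h3, Nat.add_sub_cancel_left, qBinom_symm_of_le hi]
      · ring
      · intro C hC
        obtain ⟨h4, h5, h6⟩ := mem_relDisj_self.1 hC
        have h7 := card_relDisj h5 h2 i
        rw [h3, h6, hZ, show finrank F P + (M + N) - (finrank F P + (M - i)) = N + i by omega,
          show finrank F P + M - (finrank F P + (M - i)) = i by omega,
          prod_qInt_sub_div hq, ← pow_two] at h7
        rw [← h7]
        congr 2
        ext W'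
        rw [Finset.mem_filter, Finset.mem_filter, mem_relDisj_self, mem_relDisj]
        constructor
        · rintro ⟨⟨⟨h8, h9, h10⟩, h11⟩, rfl⟩
          exact ⟨inf_le_right, h9, by omega, inf_comm _ _⟩
        · rintro ⟨h8, h9, h10, h11⟩
          rw [inf_comm] at h11
          exact ⟨⟨⟨h4.trans h8, h9, by omega⟩, by rw [h11]; omega⟩, h11⟩
    · intro W' hW'
      rw [Finset.mem_coe, Finset.mem_filter, mem_relDisj_self] at hW'
      change W ⊓ W' ∈ _
      exact mem_relDisj_self.2 ⟨le_inf h1 hW'.1.1, inf_le_left, by have := hW'.2; omega⟩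
  · rw [qBinom_eq_zero (a := M) (by omega), mul_zero, zero_mul, Nat.cast_eq_zero,
      Finset.card_eq_zero, Finset.filter_eq_empty_iff]
    intro W' hW' h
    have := (finrank_inf_add_le hW hW').1
    omega

/-- Terms with `i > M` vanish, so the sum may run up to any larger bound. -/
theorem sum_relDisj_eq_sum_range (hZ : finrank F Z = finrank F P + (M + N))
    (hW : W ∈ relDisj P P Z M) (φ : ℕ → ℝ) :
    ∑ W' ∈ relDisj P P Z M, φ (finrank F P + M - finrank F ↥(W ⊓ W')) =
      ∑ i ∈ Finset.range (finrank F P + M + 1),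
        (Nat.card F : ℝ) ^ i ^ 2 * qBinom (Nat.card F) M i * qBinom (Nat.card F) N i * φ i := by
  classical
  rw [← Finset.sum_fiberwise_of_maps_to
    (g := fun W' : Submodule F V => finrank F P + M - finrank F ↥(W ⊓ W'))
    (t := Finset.range (finrank F P + M + 1)) fun W' _ => Finset.mem_range.2 (by omega)]
  refine Finset.sum_congr rfl fun i hi => ?_
  rw [Finset.sum_congr rfl (g := fun _ => φ i) fun W' hW' => by
    rw [(Finset.mem_filter.1 hW').2], Finset.sum_const, nsmul_eq_mul,
    ← card_filter_finrank_inf hZ hW i]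
  congr 3
  refine Finset.filter_congr fun W' hW' => ?_
  have := finrank_inf_add_le hW hW'
  rw [Finset.mem_range] at hi
  omega

/-- The sum of `(q^{-i};q)_r` over the distances `i` from `W`, found by counting the pairs of an
`r`-dimensional `A` (modulo `P`) in `W` and a `W'` meeting it in `P` only. -/
theorem sum_relDisj_qPoch (hZ : finrank F Z = finrank F P + (M + N))
    (hW : W ∈ relDisj P P Z M) (r : ℕ) :
    ∑ W' ∈ relDisj P P Z M, qPoch ((Nat.card F : ℝ) ^
        (-((finrank F P + M - finrank F ↥(W ⊓ W') : ℕ) : ℤ))) (Nat.card F) r =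
      qBinom (Nat.card F) (M + N) M *
        (qPoch ((Nat.card F : ℝ) ^ (-(M : ℤ))) (Nat.card F) r *
          qPoch ((Nat.card F : ℝ) ^ (-(N : ℤ))) (Nat.card F) r /
          qPoch ((Nat.card F : ℝ) ^ (-((M + N : ℕ) : ℤ))) (Nat.card F) r) := by
  classical
  have hq : (1 : ℝ) < Nat.card F := one_lt_natCard_field
  have hq0 : (Nat.card F : ℝ) ≠ 0 := by linarith
  obtain ⟨h1, h2, h3⟩ := mem_relDisj_self.1 hW
  by_cases hr : r ≤ M
  · have hb : qBinom (Nat.card F : ℝ) M r ≠ 0 := (qBinom_pos hq hr).ne'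
    have key := Finset.sum_card_bipartiteAbove_eq_sum_card_bipartiteBelow
      (s := relDisj P P Z M) (t := relDisj P P W r)
      (fun W' A : Submodule F V => A ⊓ W' = P)
    have key' := congrArg (fun n : ℕ => (n : ℝ)) key
    simp only [Nat.cast_sum] at key'
    rw [Finset.sum_congr rfl (g := fun W' => ∏ j ∈ Finset.range r, (qInt (Nat.card F) (M - j) -
        qInt (Nat.card F) (M - (finrank F P + M - finrank F ↥(W ⊓ W')))) /
          qInt (Nat.card F) (j + 1)),
      Finset.sum_congr (s₁ := relDisj P P W r) rfl (g := fun _ =>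
        (Nat.card F : ℝ) ^ (r * M) * qBinom (Nat.card F) (M + N - r) M), Finset.sum_const,
      nsmul_eq_mul, card_relDisj_self h1, h3, Nat.add_sub_cancel_left,
      pow_mul_qBinom_sub hq (by omega)] at key'
    · refine mul_left_cancel₀ hb ?_
      rw [Finset.mul_sum, Finset.sum_congr rfl fun W' hW' => by
        rw [← qPoch_mul_prod hq (by have := finrank_inf_add_le hW hW'; omega) hr],
        ← Finset.sum_mul, key']
      ring
    · intro A hA
      obtain ⟨h4, h5, h6⟩ := mem_relDisj_self.1 hA
      have h7 := card_relDisj h4 (h5.trans h2) M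
      have hAZ := Submodule.finrank_mono h5
      rw [h6, hZ, Nat.add_sub_cancel_left, Nat.add_sub_cancel_left,
        show M + N = (M + N - r) + r by omega, prod_qInt_sub_div hq] at h7
      rw [← h7]
      congr 2
      ext W'
      rw [Finset.mem_bipartiteBelow, mem_relDisj_self, mem_relDisj, inf_comm]
      tauto
    · intro W' hW'
      have h4 := finrank_inf_add_le hW hW'
      have h7 := card_relDisj (C := P) (U := W ⊓ W') (Z := W)
        (le_inf h1 (mem_relDisj_self.1 hW').1) inf_le_left r
      rw [h3, Nat.add_sub_cancel_left, show finrank F ↥(W ⊓ W') - finrank F P =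
        M - (finrank F P + M - finrank F ↥(W ⊓ W')) by omega] at h7
      rw [← h7]
      congr 2
      ext A
      rw [Finset.mem_bipartiteAbove, mem_relDisj_self, mem_relDisj]
      constructor
      · rintro ⟨⟨h8, h9, h10⟩, h11⟩
        exact ⟨h8, h9, h10, by rw [← inf_assoc, inf_eq_left.2 h9, h11]⟩
      · rintro ⟨h8, h9, h10, h11⟩
        exact ⟨⟨h8, h9, h10⟩, by rw [← h11, ← inf_assoc, inf_eq_left.2 h9]⟩
  · rw [qPoch_inv_pow_eq_zero hq0 (x := M) (by omega), zero_mul, zero_div, mul_zero]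
    refine Finset.sum_eq_zero fun W' hW' => qPoch_inv_pow_eq_zero hq0 ?_
    have := finrank_inf_add_le hW hW'
    omega

end Interval

section GrSubset

open Module

variable {F : Type*} [Field F] {V : Type*} [AddCommGroup V] [Module F V]

theorem finrank_span_image_basis {n : ℕ} (v : Basis (Fin n) F V) (s : Set (Fin n)) :
    finrank F (Submodule.span F (v '' s)) = Nat.card s := by
  classical
  have h := finrank_span_eq_card (R := F) (b := fun i : s => v i)
    (v.linearIndependent.comp _ Subtype.val_injective)
  rw [Set.image_eq_range, h, Nat.card_eq_fintype_card]

theorem finrank_span_image_lt {n l : ℕ} (v : Basis (Fin n) F V) (hl : l ≤ n) :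
    finrank F (Submodule.span F (v '' {j | (j : ℕ) < l})) = l := by
  rw [finrank_span_image_basis, Nat.card_congr
    (Equiv.ofBijective (fun j : {j : Fin n | (j : ℕ) < l} => (⟨j.1, j.2⟩ : Fin l)) ?_),
    Nat.card_eq_fintype_card, Fintype.card_fin]
  constructor
  · intro i j h
    exact Subtype.ext (Fin.ext (Fin.mk.inj_iff.1 h))
  · intro i
    exact ⟨⟨⟨i, by omega⟩, i.2⟩, rfl⟩

theorem finrank_span_image_ge {n k : ℕ} (v : Basis (Fin n) F V) :
    finrank F (Submodule.span F (v '' {j | k ≤ (j : ℕ)})) = n - k := by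
  rw [finrank_span_image_basis, Nat.card_congr
    (Equiv.ofBijective (fun j : {j : Fin n | k ≤ (j : ℕ)} => (⟨j.1 - k, by
      have h1 : k ≤ (j.1 : ℕ) := j.2
      have h2 := j.1.2
      omega⟩ : Fin (n - k))) ?_),
    Nat.card_eq_fintype_card, Fintype.card_fin]
  constructor
  · intro i j h
    have h1 : k ≤ (i.1 : ℕ) := i.2
    have h2 : k ≤ (j.1 : ℕ) := j.2
    have h3 : (i.1 : ℕ) - k = j.1 - k := Fin.mk.inj_iff.1 h
    exact Subtype.ext (Fin.ext (by omega))
  · intro i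
    exact ⟨⟨⟨i + k, by omega⟩, Nat.le_add_left k i⟩, Fin.ext (Nat.add_sub_cancel _ _)⟩

theorem span_image_inf_eq_bot {n k l : ℕ} (v : Basis (Fin n) F V) (hlk : l ≤ k) :
    Submodule.span F (v '' {j | (j : ℕ) < l}) ⊓ Submodule.span F (v '' {j | k ≤ (j : ℕ)}) = ⊥ := by
  refine disjoint_iff.1 (v.linearIndependent.disjoint_span_image ?_)
  rw [Set.disjoint_left]
  intro j h1 h2
  have h1' : (j : ℕ) < l := h1
  have h2' : k ≤ (j : ℕ) := h2
  omega

variable [FiniteDimensional F V]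

/-- `Gr(n,m|k,l)` is an interval in the lattice of subspaces. -/
theorem mem_grSubset_iff {n m k l : ℕ} (v : Basis (Fin n) F V) (hk : k ≤ n) (hlm : l ≤ m)
    (hlk : l ≤ k) (W : Gr F V m) : W ∈ grSubset v m k l ↔
      Submodule.span F (v '' {j | (j : ℕ) < l}) ≤ W.1 ∧
      W.1 ≤ Submodule.span F (v '' {j | (j : ℕ) < l}) ⊔
        Submodule.span F (v '' {j | k ≤ (j : ℕ)}) := by
  have hP := finrank_span_image_lt v (hlk.trans hk)
  have hPQ := span_image_inf_eq_bot v hlk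
  change _ ≤ _ ∧ _ ↔ _
  set P := Submodule.span F (v '' {j | (j : ℕ) < l})
  set Q := Submodule.span F (v '' {j | k ≤ (j : ℕ)})
  have hdim : finrank F ↥(P ⊔ W.1 ⊓ Q) = l + finrank F ↥(W.1 ⊓ Q) := by
    have h1 := Submodule.finrank_sup_add_finrank_inf_eq P (W.1 ⊓ Q)
    have h2 : P ⊓ (W.1 ⊓ Q) = ⊥ := le_bot_iff.1 ((inf_le_inf_left P inf_le_right).trans hPQ.le)
    rwa [h2, finrank_bot, add_zero, hP] at h1
  have hW := W.2
  refine and_congr_right fun hPW => ⟨fun h => ?_, fun h => ?_⟩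
  · have h1 : P ⊔ W.1 ⊓ Q = W.1 :=
      Submodule.eq_of_le_of_finrank_eq (sup_le hPW inf_le_left) (by omega)
    rw [← h1]
    exact sup_le_sup_left inf_le_right P
  · have h1 : P ⊔ W.1 ⊓ Q = W.1 := by
      rw [inf_comm, ← sup_inf_assoc_of_le Q hPW, inf_eq_right.2 h]
    rw [h1] at hdim
    omega

variable [Finite F]

open Classical in
theorem sum_grSubset_eq {n m k l : ℕ} (v : Basis (Fin n) F V) (hk : k ≤ n) (hlm : l ≤ m)
    (hlk : l ≤ k) (φ : Submodule F V → ℝ) :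
    ∑ W : Gr F V m with W ∈ grSubset v m k l, φ W.1 =
      ∑ W ∈ relDisj (Submodule.span F (v '' {j | (j : ℕ) < l}))
        (Submodule.span F (v '' {j | (j : ℕ) < l}))
        (Submodule.span F (v '' {j | (j : ℕ) < l}) ⊔
          Submodule.span F (v '' {j | k ≤ (j : ℕ)})) (m - l), φ W := by
  have hP := finrank_span_image_lt v (hlk.trans hk)
  refine Finset.sum_bij (fun W _ => W.1) ?_ ?_ ?_ ?_
  · intro W hW
    have h := (mem_grSubset_iff v hk hlm hlk W).1 (Finset.mem_filter.1 hW).2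
    have := W.2
    exact mem_relDisj_self.2 ⟨h.1, h.2, by omega⟩
  · intro W _ W' _ h; exact Subtype.ext h
  · intro W hW
    obtain ⟨h1, h2, h3⟩ := mem_relDisj_self.1 hW
    refine ⟨⟨W, by omega⟩, Finset.mem_filter.2 ⟨Finset.mem_univ _, ?_⟩, rfl⟩
    exact (mem_grSubset_iff v hk hlm hlk ⟨W, by omega⟩).2 ⟨h1, h2⟩
  · intro W _; rfl

end GrSubset

end

noncomputable section

/-! ### The two evaluations of `p̃` -/

section Evaluation

open Module

variable {F : Type*} [Field F] [Finite F] {V : Type*} [AddCommGroup V] [Module F V]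
  [FiniteDimensional F V]

/-- If the sum of `φ` over the distances from a member of `Gr(n,m|k,l)` to all the others is a
constant `c`, then `p̃` is a multiple of `c`, where `φ` is the `q`-Hahn polynomial. -/
theorem pTilde_eq_of_sum_eq {n m k l x : ℕ} (v : Basis (Fin n) F V) (hm : 2 * m ≤ n) (hk : k ≤ n)
    (hl : m + k ≤ l + n) (hlm : l ≤ m) (hlk : l ≤ k) (hx : x ≤ m) (c : ℝ)
    (hc : ∀ P Z W : Submodule F V, finrank F P = l →
      finrank F Z = finrank F P + ((m - l) + (n + l - m - k)) → W ∈ relDisj P P Z (m - l) →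
      ∑ W' ∈ relDisj P P Z (m - l),
        qHahnValue (Nat.card F) n m x (finrank F P + (m - l) - finrank F ↥(W ⊓ W')) = c) :
    pTilde v m k l x = ((qPrefactor (Nat.card F) n m x * c : ℝ) : ℂ) := by
  classical
  have hn : finrank F V = n := by rw [finrank_eq_card_basis v, Fintype.card_fin]
  have hP := finrank_span_image_lt v (hlk.trans hk)
  have hQ := finrank_span_image_ge (k := k) v
  have hPQ := Submodule.finrank_sup_add_finrank_inf_eq
    (Submodule.span F (v '' {j | (j : ℕ) < l})) (Submodule.span F (v '' {j | k ≤ (j : ℕ)}))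
  rw [span_image_inf_eq_bot v hlk, finrank_bot, add_zero, hP, hQ] at hPQ
  have hsum := sum_grSubset_eq v hk hlm hlk
  have hpos : qBinom (Nat.card F) (n - k) (m - l) ≠ 0 :=
    (qBinom_pos (one_lt_natCard_field (F := F)) (by omega)).ne'
  rw [pTilde_eq_sum v hm hx (by omega)]
  refine congrArg _ ?_
  have h1 : ∀ W : Gr F V m, ∑ W' : Gr F V m with W' ∈ grSubset v m k l, sphFun x W W' =
      ∑ W' ∈ relDisj _ _ _ (m - l),
        qHahnValue (Nat.card F) n m x (m - finrank F ↥(W.1 ⊓ W')) := fun W => by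
    rw [← hsum]
    refine Finset.sum_congr rfl fun W' _ => ?_
    rw [sphFun, hn]
  simp only [h1]
  rw [hsum fun W => ∑ W' ∈ relDisj _ _ _ (m - l),
    qHahnValue (Nat.card F) n m x (m - finrank F ↥(W ⊓ W')),
    Finset.sum_congr rfl (g := fun _ => c) fun W hW => by
      have h := hc _ _ W hP (by omega) hW
      simp only [hP, Nat.add_sub_cancel' hlm] at h
      exact h,
    Finset.sum_const, nsmul_eq_mul, card_relDisj_self le_sup_left, hPQ, hP, Nat.add_sub_cancel_left]
  field_simp

theorem pTilde_eq_sum_qHahnValue {n m k l x : ℕ} (v : Basis (Fin n) F V) (hm : 2 * m ≤ n)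
    (hk : k ≤ n) (hl : m + k ≤ l + n) (hlm : l ≤ m) (hlk : l ≤ k) (hx : x ≤ m) :
    pTilde v m k l x = ((qPrefactor (Nat.card F) n m x * ∑ i ∈ Finset.range (m + 1),
      (Nat.card F : ℝ) ^ i ^ 2 * qBinom (Nat.card F) (m - l) i *
        qBinom (Nat.card F) (n + l - m - k) i * qHahnValue (Nat.card F) n m x i : ℝ) : ℂ) := by
  refine pTilde_eq_of_sum_eq v hm hk hl hlm hlk hx _ fun P Z W hP hZ hW => ?_
  rw [sum_relDisj_eq_sum_range hZ hW, hP, Nat.add_sub_cancel' hlm]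

theorem pTilde_eq_qRacahPmf {n m k l x : ℕ} (v : Basis (Fin n) F V) (hm : 2 * m ≤ n)
    (hk : k ≤ n) (hl : m + k ≤ l + n) (hlm : l ≤ m) (hlk : l ≤ k) (hx : x ≤ m) :
    pTilde v m k l x = (qRacahPmf (Nat.card F) n m k l x : ℂ) := by
  have hq : (1 : ℝ) < Nat.card F := one_lt_natCard_field
  have hq0 : (Nat.card F : ℝ) ≠ 0 := by linarith
  rw [qRacahPmf_eq_sum hq0, mul_comm (qBinom _ _ _), mul_assoc]
  refine pTilde_eq_of_sum_eq v hm hk hl hlm hlk hx _ fun P Z W hP hZ hW => ?_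
  simp only [qHahnValue_eq_sum hq0]
  rw [Finset.sum_comm, Finset.mul_sum]
  refine Finset.sum_congr rfl fun r _ => ?_
  rw [← Finset.mul_sum, sum_relDisj_qPoch hZ hW, show (m - l) + (n + l - m - k) = n - k by omega,
    show (-((m - l : ℕ) : ℤ) - ((n + l - m - k : ℕ) : ℤ)) = -((n - k : ℕ) : ℤ) by omega]
  ring

end Evaluation

end

theorem mainTheorem4 {F : Type*} [Field F] [Finite F] {V : Type*} [AddCommGroup V] [Module F V]
    [FiniteDimensional F V] (q : ℕ) (hq : Nat.card F = q) (n m k l : ℕ)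
    (v : Module.Basis (Fin n) F V) (hm : m ≤ n / 2) (hk : k ≤ n) (hl : m + k ≤ l + n)
    (hlm : l ≤ m) (hlk : l ≤ k) :
    -- `V_0, …, V_m` are the irreducible constituents of `1_K^G`, with their dimensions
    ((∀ x ≤ m, (irrepRep F V m x).IsIrreducible) ∧
      DirectSum.IsInternal (fun x : Fin (m + 1) => (irrepV F V m x).toSubmodule) ∧
      ∀ x ≤ m, (Module.finrank ℂ (irrepV F V m x).toSubmodule : ℝ) =
        (q : ℝ) ^ x * (qInt q (n - 2 * x + 1) / qInt q (n - x + 1)) * qBinom q n x) ∧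
    ∀ x ≤ m,
      -- the presentation by zonal spherical functions
      (∀ U : Gr F V m, ∀ g : ℕ → (V ≃ₗ[F] V), (∀ i ≤ m, g i ∈ doubleCosetK U i) →
        pTilde v m k l x = (qPrefactor q n m x : ℂ) * ∑ i ∈ Finset.range (m + 1),
          ((q ^ i ^ 2 * qBinom q (m - l) i * qBinom q (n + l - m - k) i : ℝ) : ℂ) *
            zonalSpherical U x (g i)) ∧
      -- the `q`-Hahn presentation
      pTilde v m k l x = ((qPrefactor q n m x * ∑ i ∈ Finset.range (m + 1),
        (q : ℝ) ^ i ^ 2 * qBinom q (m - l) i * qBinom q (n + l - m - k) i *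
          qHahnValue q n m x i : ℝ) : ℂ) ∧
      -- the equality with `p(x;q)` and its positivity
      pTilde v m k l x = (qRacahPmf q n m k l x : ℂ) ∧
      0 ≤ qRacahPmf q n m k l x := by
  subst hq
  have hm' : 2 * m ≤ n := by omega
  have hn : Module.finrank F V = n := by rw [Module.finrank_eq_card_basis v, Fintype.card_fin]
  have hmV : 2 * m ≤ Module.finrank F V := by omega
  refine ⟨⟨fun x hx => isIrreducible_irrepRep hmV hx, isInternal_irrepV hmV, fun x hx => ?_⟩,
    fun x hx => ⟨fun U g hg => ?_, pTilde_eq_sum_qHahnValue v hm' hk hl hlm hlk hx,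
      pTilde_eq_qRacahPmf v hm' hk hl hlm hlk hx, ?_⟩⟩
  · rw [finrank_irrepV hx hmV, hn]
  · rw [pTilde_eq_sum_qHahnValue v hm' hk hl hlm hlk hx, Complex.ofReal_mul, Complex.ofReal_sum]
    refine congrArg _ (Finset.sum_congr rfl fun i hi => ?_)
    have h : Module.finrank F ↥(U.1 ⊓ (g i • U).1) + i = m :=
      hg i (Nat.lt_succ_iff.1 (Finset.mem_range.1 hi))
    rw [zonalSpherical_eq_sphFun hmV hx, sphFun, hn, Complex.ofReal_mul]
    congr 3
    omega
  · have h := pTilde_re_nonneg v m k l x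
    rwa [pTilde_eq_qRacahPmf v hm' hk hl hlm hlk hx, Complex.ofReal_re] at h
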